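/- Setting. Let $\mathcal S,\mathcal A$ be measurable state and action spaces, $P(ds'\mid s,a)$ a transition kernel, $\mu_0$ an initial state distribution, $\gamma\in[0,1)$ a discount factor and $H\ge 1$ a horizon. Let $\phi:\mathcal S\to\mathbb R^d$ be a measurable feature map, $\mathcal Z\subseteq\mathbb R^d$ a set of task embeddings, $(\pi_z)_{z\in\mathcal Z}$ a (jointly measurable) family of policies, $\psi(s,a,z)\in\mathbb R^d$ a model of their successor features, $\psi(s,z)=\mathbb E_{a\sim\pi_z(\cdot\mid s)}\psi(s,a,z)$, and $z_r\in\mathcal Z$. The agent interacts with the environment in episodes of length $H$: with $s_{k,t}$ the state at step $t<H$ of episode $k=1,2,\dots$, $s_{k,0}\sim\mu_0$ independently of the past; the agent chooses $z_k\in\mathcal Z$ from the information available at the start of episode $k$ (including $s_{k,0}$); then $a_{k,t}\sim\pi_{z_k}(\cdot\mid s_{k,t})$, $s_{k,t+1}\sim P(\cdot\mid s_{k,t},a_{k,t})$, and the reward $r_{k,t}$ is observed. Write $\hat G_k=\sum_{t=0}^{H-1}\gamma^t r_{k,t}$. Assume: (A1) $\psi(s_0,a_0,z)=\sum_{t=0}^{H-1}\gamma^t\,\mathbb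 E[\phi(s_t)\mid s_0,a_0,\pi_z]$ for all $s_0,a_0,z$, and $\pi_z(\cdot\mid s)$ is concentrated on $\arg\max_a\langle\psi(s,a,z),z\rangle$ for all $s,z$. (A2) $r_{k,t}=\langle\phi(s_{k,t}),z_r\rangle+\eta_{k,t}$, where the $\eta_{k,t}$ are i.i.d., centred, $\sigma$-subgaussian, and each $\eta_{k,t}$ is independent of the history up to and including $s_{k,t}$. (A3) and the algorithm. Let $\lambda>0$, $\delta=1/n$ and, for $k\ge1$, $$V_{k}=\lambda I+\sum_{i=1}^{k}\sum_{t=0}^{H-1}\phi(s_{i,t})\phi(s_{i,t})^\top,\qquad \hat z_k=V_k^{-1}\sum_{i=1}^{k}\sum_{t=0}^{H-1}r_{i,t}\,\phi(s_{i,t}),$$ with $V_0=\lambda I$, $\hat z_0=0$, and $$\beta_k=\sqrt\lambda\,S+\sigma\sqrt{\log\frac{\det V_{k-1}}{\lambda^d}+2\log\frac1\delta},\qquad \mathcal C_k=\{w\in\mathbb R^d:\|w-\hat z_{k-1}\|_{V_{k-1}}\le\beta_k\},$$ where $\|x\|_V=\sqrt{x^\top Vx}$. In each episode $k\le n$ the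 episodic variant of OpTI-BFM uses an exact maximizer $z_k\in\arg\max_{z\in\mathcal Z}\max_{w\in\mathcal C_k}\langle\psi(s_{k,0},z),w\rangle$. (A4) $\|z_r\|_2\le S$ and $\|\phi(s)\|_2\le L$ for all $s$, with $S,L>0$. Let $\hat G_k^\star$ be the discounted return of episode $k$ in an interaction of the same kind that uses $z_r$ in every episode. Proposition. There is a constant $C$ that depends only on $\gamma,\lambda,S,L,\sigma$ such that, for every $d$, every $H\ge1$, every $n\ge 1$ and every setting as above, the regret $\sum_{k=1}^n(\hat G_k^\star-\hat G_k)$ is integrable and $$R_n=\mathbb E\Big[\sum_{k=1}^n\big(\hat G_k^\star-\hat G_k\big)\Big]\le C\,d\,\sqrt n\,\log(1+nH).$$ In particular the expected regret over $n$ episodes is $\tilde{\mathcal O}(d\sqrt n)$. -/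

import Mathlib

open MeasureTheory ProbabilityTheory
open scoped NNReal ENNReal Matrix InnerProductSpace

noncomputable section

namespace OptiBFM

/-- The Euclidean space `ℝ^d` of features, successor features and task embeddings. -/
abbrev Vec (d : ℕ) := EuclideanSpace ℝ (Fin d)

/-- A reward-free Markov decision process: transition probabilities and initial distribution.
The discount factor and the horizon are kept as separate parameters. -/
structure MDP (St Ac : Type*) [MeasurableSpace St] [MeasurableSpace Ac] where
  /-- `P (s, a)` is the law of the next state. -/
  P : Kernel (St × Ac) St
  /-- The law of the initial state of an episode. -/
  μ₀ : Measure St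
  isMarkov : IsMarkovKernel P
  isProb : IsProbabilityMeasure μ₀

/-- A behavior foundation model with set of task embeddings `Z ⊆ ℝ^d`: a measurable feature map,
a family of policies `π (z, s) = π_z(· | s)`, and a model `ψ s a z` of the
successor features of the policies. -/
structure BFM {d : ℕ} (Z : Set (Vec d)) (St Ac : Type*)
    [MeasurableSpace St] [MeasurableSpace Ac] where
  φ : St → Vec d
  φ_measurable : Measurable φ
  π : Kernel (Z × St) Ac
  isMarkov : IsMarkovKernel π
  ψ : St → Ac → Z → Vec d

attribute [instance] MDP.isMarkov MDP.isProb BFM.isMarkov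

section Rollout

variable {St Ac : Type*} [MeasurableSpace St] [MeasurableSpace Ac]

/-- The law of `(s_t, a_t)` when the rollout starts with the state `s₀` and the action `a₀` and
then follows `s_{t+1} ∼ P(· | s_t, a_t)`, `a_{t+1} ∼ p(· | s_{t+1})`, for the policy `p`. -/
def rolloutLaw (M : MDP St Ac) (p : Kernel St Ac) (s₀ : St) (a₀ : Ac) : ℕ → Measure (St × Ac)
  | 0 => Measure.dirac (s₀, a₀)
  | t + 1 => ((rolloutLaw M p s₀ a₀ t).bind M.P) ⊗ₘ p

/-- The discounted successor features with horizon `H` of the policy `p`: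
`∑_{t < H} γ^t E[φ(s_t) | s₀, a₀, p]`. -/
def successorFeatures {d : ℕ} (M : MDP St Ac) (φ : St → Vec d) (γ : ℝ) (H : ℕ)
    (p : Kernel St Ac) (s₀ : St) (a₀ : Ac) : Vec d :=
  ∑ t ∈ Finset.range H, γ ^ t • ∫ x, φ x.1 ∂(rolloutLaw M p s₀ a₀ t)

variable {d : ℕ} {Z : Set (Vec d)}

/-- The policy `π_z`. -/
def BFM.policy (B : BFM Z St Ac) (z : Z) : Kernel St Ac := Kernel.sectR B.π z

/-- `ψ(s, z)`, the mean of `ψ(s, a, z)` over the actions `a ∼ π_z(· | s)`. -/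
def BFM.ψState (B : BFM Z St Ac) (s : St) (z : Z) : Vec d :=
  ∫ a, B.ψ s a z ∂(B.π (z, s))

/-- The model is a perfect universal successor feature: `ψ(s, a, z)` are the exact
`H`-step successor features of `π_z`, and `π_z` only plays actions that are greedy with respect
to `⟨ψ(s, ·, z), z⟩` (for countably many actions: every action of positive probability is
greedy). -/
structure BFM.IsPerfectUSF (B : BFM Z St Ac) (M : MDP St Ac) (γ : ℝ) (H : ℕ) : Prop where
  exact : ∀ s a z, B.ψ s a z = successorFeatures M B.φ γ H (B.policy z) s a
  greedy : ∀ s z, ∀ᵐ a ∂(B.π (z, s)), ∀ a', ⟪B.ψ s a' z, (z : Vec d)⟫_ℝ ≤ ⟪B.ψ s a z, (z : Vec d)⟫_ℝ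

end Rollout

section LeastSquares

variable {d : ℕ}

/-- The regularized design matrix `lam • I + ∑_{i < m} f_i f_iᵀ` after `m` observed steps. -/
def gram (lam : ℝ) (f : ℕ → Vec d) (m : ℕ) : Matrix (Fin d) (Fin d) ℝ :=
  lam • (1 : Matrix (Fin d) (Fin d) ℝ) +
    ∑ i ∈ Finset.range m, Matrix.vecMulVec (f i).ofLp (f i).ofLp

/-- The least-squares estimate from the `m` pairs (feature, reward) `(f i, r i)`, `i < m`. -/
def lsEstimate (lam : ℝ) (f : ℕ → Vec d) (r : ℕ → ℝ) (m : ℕ) : Vec d :=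
  WithLp.toLp 2 ((gram lam f m)⁻¹ *ᵥ (∑ i ∈ Finset.range m, r i • f i).ofLp)

/-- The weighted norm `‖x‖_V = √(xᵀ V x)`. -/
def wnorm (V : Matrix (Fin d) (Fin d) ℝ) (x : Vec d) : ℝ :=
  √(x.ofLp ⬝ᵥ (V *ᵥ x.ofLp))

/-- The radius `√lam S + σ √(log (det V / lam^d) + 2 log (1/δ))`, where `V` is the design matrix
after `m` observed steps. -/
def radius (lam S σ δ : ℝ) (f : ℕ → Vec d) (m : ℕ) : ℝ :=
  √lam * S + σ * √(Real.log ((gram lam f m).det / lam ^ d) + 2 * Real.log (1 / δ))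

/-- The confidence ellipsoid after `m` observed steps. -/
def confidenceSet (lam S σ δ : ℝ) (f : ℕ → Vec d) (r : ℕ → ℝ) (m : ℕ) : Set (Vec d) :=
  {w | wnorm (gram lam f m) (w - lsEstimate lam f r m) ≤ radius lam S σ δ f m}

/-- The largest value of `⟨x, w⟩` for `w` in the confidence ellipsoid. -/
def ucb (lam S σ δ : ℝ) (f : ℕ → Vec d) (r : ℕ → ℝ) (m : ℕ) (x : Vec d) : ℝ :=
  sSup ((fun w => ⟪x, w⟫_ℝ) '' confidenceSet lam S σ δ f r m)

end LeastSquares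

section Interaction

variable {Ω : Type*} [mΩ : MeasurableSpace Ω]

/-- Given the past `m`, the random variable `Y` has the conditional law `κ ω`:
`μ(C ∩ {Y ∈ D}) = E[1_C κ(D)]` for all events `C` of the past and all measurable `D`. -/
def HasCondLaw {β : Type*} [MeasurableSpace β] (μ : Measure Ω) (m : MeasurableSpace Ω)
    (Y : Ω → β) (κ : Ω → Measure β) : Prop :=
  ∀ C, MeasurableSet[m] C → ∀ D, MeasurableSet D →
    μ (C ∩ Y ⁻¹' D) = ∫⁻ ω in C, κ ω D ∂μ

variable {St Ac : Type*} [MeasurableSpace St] [MeasurableSpace Ac]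
  {d : ℕ} {Z : Set (Vec d)}

/-- The law of the state that follows the state `s` at time `τ`, as a function of the action:
within an episode it is `P(· | s, a)`; if time `τ` is the last one of an episode of length `H`,
then a new episode starts, from `μ₀`. -/
def nextState (M : MDP St Ac) (H : ℕ) (τ : ℕ) (s : St) : Kernel Ac St :=
  if H ∣ τ + 1 then Kernel.const Ac M.μ₀ else Kernel.sectR M.P s

/-- An interaction with the environment in episodes of length `H`. Time is counted through all
episodes: time `k * H + t` is step `t` of episode `k` (both counted from `0`). The σ-algebra `ℱ τ`
is the information available at time `τ`, after the state `s τ` and before the action `a τ` and the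
reward noise `η τ`; it may be the one generated by the history or a larger one.
In episode `k` the actions are sampled from the policy of the task embedding `z k`, which is
chosen at the start of the episode. -/
structure IsInteraction (μ : Measure Ω) (M : MDP St Ac) (B : BFM Z St Ac) (H : ℕ)
    (ℱ : Filtration ℕ mΩ) (z : ℕ → Ω → Z) (s : ℕ → Ω → St) (a : ℕ → Ω → Ac)
    (η : ℕ → Ω → ℝ) : Prop where
  embedding_measurable : ∀ k, Measurable[ℱ (k * H)] (z k)
  state_measurable : ∀ τ, Measurable[ℱ τ] (s τ)
  action_measurable : ∀ τ, Measurable[ℱ (τ + 1)] (a τ)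
  noise_measurable : ∀ τ, Measurable[ℱ (τ + 1)] (η τ)
  init : μ.map (s 0) = M.μ₀
  step : ∀ τ, HasCondLaw μ (ℱ τ) (fun ω => (a τ ω, s (τ + 1) ω))
    (fun ω => B.π (z (τ / H) ω, s τ ω) ⊗ₘ nextState M H τ (s τ ω))

/-- The reward noise is i.i.d., centred and `σ`-subgaussian. Each `η τ` is independent of the
information `ℱ τ` available before it; as the earlier noise variables are part of that
information, this contains the mutual independence of the noise. -/
structure IsSubgaussianNoise (μ : Measure Ω) (ℱ : Filtration ℕ mΩ) (σ : ℝ≥0)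
    (η : ℕ → Ω → ℝ) : Prop where
  identDistrib : ∀ τ, IdentDistrib (η τ) (η 0) μ μ
  indep : ∀ τ, Indep (MeasurableSpace.comap (η τ) inferInstance) (ℱ τ) μ
  mean_zero : ∀ τ, ∫ ω, η τ ω ∂μ = 0
  subgaussian : ∀ τ, HasSubgaussianMGF (η τ) (σ ^ 2) μ

/-- The reward `⟨φ(s_τ), z_r⟩ + η_τ` at time `τ`. -/
def reward (B : BFM Z St Ac) (zr : Z) (s : ℕ → Ω → St) (η : ℕ → Ω → ℝ) (τ : ℕ) (ω : Ω) : ℝ :=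
  ⟪B.φ (s τ ω), (zr : Vec d)⟫_ℝ + η τ ω

/-- The discounted return of episode `k`. -/
def episodeReturn (γ : ℝ) (H : ℕ) (r : ℕ → Ω → ℝ) (k : ℕ) (ω : Ω) : ℝ :=
  ∑ t ∈ Finset.range H, γ ^ t * r (k * H + t) ω

/-- The upper confidence bound `UCB_k(z)` at the start of episode `k`, from the pairs
(feature, reward) of all steps of the earlier episodes. -/
def episodeUCB (B : BFM Z St Ac) (H : ℕ) (lam S σ δ : ℝ) (s : ℕ → Ω → St) (r : ℕ → Ω → ℝ)
    (k : ℕ) (ω : Ω) (z : Z) : ℝ :=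
  ucb lam S σ δ (fun τ => B.φ (s τ ω)) (fun τ => r τ ω) (k * H) (B.ψState (s (k * H) ω) z)

/-- For `n` episodes, the task embedding of each episode is an exact maximizer over `Z` of the
upper confidence bound at the start of the episode. -/
def IsOptimistic (μ : Measure Ω) (B : BFM Z St Ac) (H : ℕ) (lam S σ δ : ℝ) (n : ℕ)
    (z : ℕ → Ω → Z) (s : ℕ → Ω → St) (r : ℕ → Ω → ℝ) : Prop :=
  ∀ k < n, ∀ᵐ ω ∂μ, ∀ z', episodeUCB B H lam S σ δ s r k ω z' ≤
    episodeUCB B H lam S σ δ s r k ω (z k ω)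

/-- The regret `∑_{k < n} (Ĝ⋆_k - Ĝ_k)` of the rewards `r` against the rewards `r'`, of which the
expected regret is the mean. -/
def regret (γ : ℝ) (H n : ℕ) (r' r : ℕ → Ω → ℝ) (ω : Ω) : ℝ :=
  ∑ k ∈ Finset.range n, (episodeReturn γ H r' k ω - episodeReturn γ H r k ω)

end Interaction

end OptiBFM

end

namespace OptiBFM

/-! ### Quadratic forms, rank-one updates and determinants. -/

section LinearAlgebra

variable {ι κ : Type*} [Fintype ι] [Fintype κ]

/-! This is an optimism argument in which every quantity that could grow with the horizon is tamed
either by discounting or by a logarithm. Since the noise is centred and the successor features are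
exact, the expected return of episode k is the mean of `⟪ψ(s, z_k), z_r⟫` at the initial state s,
for the algorithm and for the comparator alike. Both initial states have law `μ₀`, so the regret of
episode k is the mean of `⟪ψ(s, z_r) - ψ(s, z_k), z_r⟫`, now with a single s.

If `z_r` lies in the confidence ellipsoid, the choice of `z_k` bounds this difference by twice the
radius times `‖ψ(s, z_k)‖` in the inverse design matrix V (`inner_sub_inner_le_of_ucb_le`).
Otherwise it is at most `2 L S / (1 - γ)`; as this has probability at most `1 / n` in each episode,
it costs one such constant in total. Only an expectation is wanted, so coverage is needed at fixed
times, not uniformly in time. It follows from Markov's inequality for the self-normalized process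
`exp (‖N‖² / 2) √(lam^d / det V)`, where N is the accumulated noise: its mean stays at most 1, by a
Gaussian mixture bound at each step (`lintegral_selfNormalized_le_one`).

Two points remain. The algorithm observes features, not ψ: since ψ is the conditional mean of the
discounted feature sum and V is known at the start of the episode, `E ‖ψ‖²` is at most `(1 - γ)⁻¹`
times the mean discounted sum of the squared norms of the observed features
(`IsInteraction.integral_invForm_ψState_le`). Moreover V is updated only once per episode. The
discounted sum is bounded independently of H, hence comparable to the logarithm of one plus itself,
and the determinant grows at least by the factor one plus the undiscounted sum. The logarithms
telescope to order `d log (1 + n H)` (`sum_discounted_invForm_le`). With squared radius of the same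
order, Young's inequality with weight `√n` gives `d √n log (1 + n H)`. -/

theorem dotProduct_mulVec_symm {V : Matrix ι ι ℝ} (hV : V.IsHermitian) (x y : ι → ℝ) :
    x ⬝ᵥ (V *ᵥ y) = y ⬝ᵥ (V *ᵥ x) := by
  have h : Vᵀ = V := by simpa [Matrix.IsHermitian] using hV
  rw [Matrix.dotProduct_mulVec, ← Matrix.mulVec_transpose, h, dotProduct_comm]

theorem dotProduct_mulVec_self_nonneg {V : Matrix ι ι ℝ} (hV : V.PosSemidef) (x : ι → ℝ) :
    0 ≤ x ⬝ᵥ (V *ᵥ x) := by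
  simpa using hV.dotProduct_mulVec_nonneg x

/-- Cauchy–Schwarz for a possibly degenerate form: the quadratic polynomial of `t • x + y` is
nonnegative, so its discriminant is not positive. -/
theorem sq_dotProduct_mulVec_le {V : Matrix ι ι ℝ} (hV : V.PosSemidef) (x y : ι → ℝ) :
    (x ⬝ᵥ (V *ᵥ y)) ^ 2 ≤ (x ⬝ᵥ (V *ᵥ x)) * (y ⬝ᵥ (V *ᵥ y)) := by
  have key : ∀ t : ℝ, 0 ≤ (x ⬝ᵥ (V *ᵥ x)) * (t * t) + (2 * (x ⬝ᵥ (V *ᵥ y))) * t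
      + y ⬝ᵥ (V *ᵥ y) := by
    intro t
    have h := dotProduct_mulVec_self_nonneg hV (t • x + y)
    have hs := dotProduct_mulVec_symm hV.1 y x
    simp only [Matrix.mulVec_add, Matrix.mulVec_smul, dotProduct_add, add_dotProduct,
      smul_dotProduct, dotProduct_smul, smul_eq_mul] at h
    rw [hs] at h
    linarith
  have := discrim_le_zero key
  rw [discrim] at this
  linarith

variable [DecidableEq ι] [DecidableEq κ]

/-- The bilinear form `xᵀ V⁻¹ y`. -/
noncomputable def invForm (V : Matrix ι ι ℝ) (x y : ι → ℝ) : ℝ := x ⬝ᵥ (V⁻¹ *ᵥ y)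

theorem mulVec_inv_mulVec {V : Matrix ι ι ℝ} (hV : V.PosDef) (x : ι → ℝ) :
    V *ᵥ (V⁻¹ *ᵥ x) = x := by
  rw [Matrix.mulVec_mulVec, Matrix.mul_nonsing_inv _ ((Matrix.isUnit_iff_isUnit_det V).1 hV.isUnit),
    Matrix.one_mulVec]

theorem inv_mulVec_mulVec {V : Matrix ι ι ℝ} (hV : V.PosDef) (x : ι → ℝ) :
    V⁻¹ *ᵥ (V *ᵥ x) = x := by
  rw [Matrix.mulVec_mulVec, Matrix.nonsing_inv_mul _ ((Matrix.isUnit_iff_isUnit_det V).1 hV.isUnit),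
    Matrix.one_mulVec]

theorem invForm_comm {V : Matrix ι ι ℝ} (hV : V.PosDef) (x y : ι → ℝ) :
    invForm V x y = invForm V y x :=
  dotProduct_mulVec_symm hV.inv.1 x y

theorem invForm_self_nonneg {V : Matrix ι ι ℝ} (hV : V.PosDef) (x : ι → ℝ) :
    0 ≤ invForm V x x :=
  dotProduct_mulVec_self_nonneg hV.inv.posSemidef x

theorem sq_invForm_le {V : Matrix ι ι ℝ} (hV : V.PosDef) (x y : ι → ℝ) :
    invForm V x y ^ 2 ≤ invForm V x x * invForm V y y :=
  sq_dotProduct_mulVec_le hV.inv.posSemidef x y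

/-- Duality of the norms of `V` and `V⁻¹`: Cauchy–Schwarz for `V` applied to `w` and `V⁻¹ x`. -/
theorem sq_dotProduct_le_invForm_mul {V : Matrix ι ι ℝ} (hV : V.PosDef) (x w : ι → ℝ) :
    (x ⬝ᵥ w) ^ 2 ≤ invForm V x x * (w ⬝ᵥ (V *ᵥ w)) := by
  have h := sq_dotProduct_mulVec_le hV.posSemidef w (V⁻¹ *ᵥ x)
  rw [mulVec_inv_mulVec hV, dotProduct_comm w x, dotProduct_comm (V⁻¹ *ᵥ x) x] at h
  rw [invForm, mul_comm]
  exact h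

/-- The inverse form after a rank-one update (Sherman–Morrison). -/
theorem inv_add_vecMulVec_mulVec {V : Matrix ι ι ℝ} (hV : V.PosDef) (x y : ι → ℝ) :
    (V + Matrix.vecMulVec x x)⁻¹ *ᵥ y
      = V⁻¹ *ᵥ y - (invForm V x y / (1 + invForm V x x)) • (V⁻¹ *ᵥ x) := by
  have hV' : (V + Matrix.vecMulVec x x).PosDef :=
    hV.add_posSemidef (by simpa using Matrix.posSemidef_vecMulVec_self_star x)
  have hq : 1 + invForm V x x ≠ 0 := by have := invForm_self_nonneg hV x; positivity
  have : (V + Matrix.vecMulVec x x) *ᵥ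
      (V⁻¹ *ᵥ y - (invForm V x y / (1 + invForm V x x)) • (V⁻¹ *ᵥ x)) = y := by
    rw [Matrix.mulVec_sub, Matrix.mulVec_smul, Matrix.add_mulVec, Matrix.add_mulVec,
      mulVec_inv_mulVec hV, mulVec_inv_mulVec hV, Matrix.vecMulVec_mulVec,
      Matrix.vecMulVec_mulVec]
    ext i
    change (y i + x i * (invForm V x y)) - _ * (x i + x i * (invForm V x x)) = y i
    field_simp
    ring
  rw [← this, inv_mulVec_mulVec hV', this]

theorem det_add_vecMulVec {V : Matrix ι ι ℝ} (hV : V.PosDef) (x : ι → ℝ) :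
    (V + Matrix.vecMulVec x x).det = V.det * (1 + invForm V x x) := by
  have hu := (Matrix.isUnit_iff_isUnit_det V).1 hV.isUnit
  have h : V + Matrix.vecMulVec x x = V * (1 + (V⁻¹ * Matrix.replicateCol Unit x) *
      Matrix.replicateRow Unit x) := by
    rw [mul_add, mul_one, ← Matrix.mul_assoc, ← Matrix.mul_assoc, Matrix.mul_nonsing_inv _ hu,
      Matrix.one_mul, Matrix.vecMulVec_eq Unit]
  rw [h, Matrix.det_mul, Matrix.det_one_add_mul_comm, Matrix.det_unique (n := Unit)]
  congr 1

theorem one_add_sum_le_prod_one_add {α : Type*} (s : Finset α) {f : α → ℝ} (hf : ∀ i, 0 ≤ f i) :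
    1 + ∑ i ∈ s, f i ≤ ∏ i ∈ s, (1 + f i) := by
  classical
  induction s using Finset.induction_on with
  | empty => simp
  | insert a s ha ih =>
    rw [Finset.sum_insert ha, Finset.prod_insert ha]
    have h1 : 0 ≤ ∑ i ∈ s, f i := Finset.sum_nonneg fun i _ => hf i
    nlinarith [hf a, mul_nonneg (hf a) h1]

/-- The determinant of `1 + A` in terms of the trace of the positive semidefinite matrix `A`. -/
theorem one_add_trace_le_det_one_add {A : Matrix ι ι ℝ} (hA : A.PosSemidef) :
    1 + A.trace ≤ (1 + A).det ∧ (1 + A).det ≤ (1 + A.trace) ^ Fintype.card ι := by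
  have hdet : (1 + A).det = ∏ i, (1 + hA.1.eigenvalues i) := by
    -- The characteristic polynomial at `-1` turns the eigenvalues of `A` into the determinant of `1
    -- + A`, up to the sign `(-1) ^ card ι` on both sides.
    have h1 : A.charpoly.eval (-1) = (-(1 + A)).det := by
      rw [Matrix.eval_charpoly]
      congr 1
      ext i j
      simp [Matrix.scalar_apply, Matrix.one_apply, Matrix.diagonal_apply]
      split_ifs <;> ring
    rw [Matrix.det_neg, hA.1.charpoly_eq, Polynomial.eval_prod] at h1
    have h2 : ∏ i, (Polynomial.X - Polynomial.C (hA.1.eigenvalues i : ℝ)).eval (-1)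
        = (-1) ^ Fintype.card ι * ∏ i, (1 + hA.1.eigenvalues i) := by
      rw [← Finset.card_univ, ← Finset.prod_const, ← Finset.prod_mul_distrib]
      refine Finset.prod_congr rfl fun i _ => ?_
      simp
      ring
    simp only [RCLike.ofReal_real_eq_id, id] at h1
    rw [h2] at h1
    exact (mul_left_cancel₀ (pow_ne_zero _ (by norm_num)) h1).symm
  have htr : A.trace = ∑ i, hA.1.eigenvalues i := by
    simpa using hA.1.trace_eq_sum_eigenvalues
  have h0 := fun i => hA.eigenvalues_nonneg i
  rw [hdet, htr]
  refine ⟨one_add_sum_le_prod_one_add _ h0, ?_⟩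
  rw [← Finset.card_univ, ← Finset.prod_const]
  refine Finset.prod_le_prod (fun i _ => by have := h0 i; positivity) fun i _ => ?_
  have := Finset.single_le_sum (fun j _ => h0 j) (Finset.mem_univ i)
  linarith

/-- Factoring out `V` and exchanging the factors by Sylvester's identity leaves `det (1 + Xᵀ V⁻¹
X)`, which is at least one plus the trace. This handles a whole batch of columns, all measured in
the old matrix `V`. -/
theorem det_add_mul_transpose_ge {V : Matrix ι ι ℝ} (hV : V.PosDef) (X : Matrix ι κ ℝ) :
    V.det * (1 + ∑ t, invForm V (Xᵀ t) (Xᵀ t)) ≤ (V + X * Xᵀ).det := by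
  have hu := (Matrix.isUnit_iff_isUnit_det V).1 hV.isUnit
  have h : V + X * Xᵀ = V * (1 + (V⁻¹ * X) * Xᵀ) := by
    rw [mul_add, mul_one, ← Matrix.mul_assoc, ← Matrix.mul_assoc, Matrix.mul_nonsing_inv _ hu,
      Matrix.one_mul]
  rw [h, Matrix.det_mul, Matrix.det_one_add_mul_comm]
  refine mul_le_mul_of_nonneg_left ?_ hV.det_pos.le
  have hp : (Xᵀ * (V⁻¹ * X)).PosSemidef := by
    have := hV.inv.posSemidef.conjTranspose_mul_mul_same X
    simpa [Matrix.mul_assoc] using this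
  refine le_of_eq_of_le ?_ (one_add_trace_le_det_one_add hp).1
  refine congrArg (1 + ·) (Finset.sum_congr rfl fun t _ => ?_)
  simp [invForm, Matrix.mul_apply, dotProduct, Matrix.mulVec]

end LinearAlgebra

/-! ### The design matrix: determinant growth and lower bound by `lam`. -/

section Gram

variable {d : ℕ} {lam : ℝ} (f : ℕ → Vec d)

theorem gram_posDef (hlam : 0 < lam) (m : ℕ) : (gram lam f m).PosDef := by
  refine (Matrix.PosDef.one.smul hlam).add_posSemidef (Matrix.posSemidef_sum _ fun i _ => ?_)
  simpa using Matrix.posSemidef_vecMulVec_self_star (f i).ofLp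

theorem gram_succ (m : ℕ) :
    gram lam f (m + 1) = gram lam f m + Matrix.vecMulVec (f m).ofLp (f m).ofLp := by
  simp [gram, Finset.sum_range_succ, add_assoc]

theorem sum_vecMulVec_eq (H : ℕ) :
    ∑ t ∈ Finset.range H, Matrix.vecMulVec (f t).ofLp (f t).ofLp
      = Matrix.of (fun i (t : Fin H) => f t i) * (Matrix.of (fun i (t : Fin H) => f t i))ᵀ := by
  ext i j
  simp [Matrix.sum_apply, Matrix.mul_apply, Matrix.vecMulVec_apply,
    Finset.sum_range (fun t => f t i * f t j)]

theorem gram_add (m H : ℕ) :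
    gram lam f (m + H) = gram lam f m + ∑ t ∈ Finset.range H,
      Matrix.vecMulVec (f (m + t)).ofLp (f (m + t)).ofLp := by
  rw [gram, gram, Finset.sum_range_add, add_assoc]

/-- The determinant of the design matrix grows by at least the sum of the squared weighted norms
of all new features, measured in the old design matrix. -/
theorem det_gram_add_ge (hlam : 0 < lam) (m H : ℕ) :
    (gram lam f m).det * (1 + ∑ t ∈ Finset.range H,
      invForm (gram lam f m) (f (m + t)).ofLp (f (m + t)).ofLp) ≤ (gram lam f (m + H)).det := by
  have h := det_add_mul_transpose_ge (gram_posDef f hlam m)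
    (Matrix.of (fun i (t : Fin H) => f (m + t) i))
  rw [gram_add, sum_vecMulVec_eq (fun t => f (m + t)), Finset.sum_range]
  exact h

theorem dotProduct_self_le {x : Vec d} {R : ℝ} (hx : ‖x‖ ≤ R) : x.ofLp ⬝ᵥ x.ofLp ≤ R ^ 2 := by
  have : x.ofLp ⬝ᵥ x.ofLp = ‖x‖ ^ 2 := by
    rw [EuclideanSpace.real_norm_sq_eq]
    simp [dotProduct, sq]
  rw [this]
  exact pow_le_pow_left₀ (norm_nonneg _) hx 2

theorem det_gram_le (hlam : 0 < lam) {L : ℝ} (hf : ∀ i, ‖f i‖ ≤ L) (m : ℕ) :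
    (gram lam f m).det / lam ^ d ≤ (1 + m * (L ^ 2 / lam)) ^ d := by
  set A : Matrix (Fin d) (Fin d) ℝ := lam⁻¹ • ∑ i ∈ Finset.range m,
    Matrix.vecMulVec (f i).ofLp (f i).ofLp with hA
  have hAp : A.PosSemidef := by
    refine Matrix.PosSemidef.smul (Matrix.posSemidef_sum _ fun i _ => ?_) (by positivity)
    simpa using Matrix.posSemidef_vecMulVec_self_star (f i).ofLp
  have h1 : gram lam f m = lam • (1 + A) := by
    rw [hA, smul_add, smul_smul, mul_inv_cancel₀ hlam.ne', one_smul, gram]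
  have htr : A.trace ≤ m * (L ^ 2 / lam) := by
    have h2 : ∀ i ∈ Finset.range m, (f i).ofLp ⬝ᵥ (f i).ofLp ≤ L ^ 2 :=
      fun i _ => dotProduct_self_le (hf i)
    have h3 := Finset.sum_le_sum h2
    simp only [Finset.sum_const, Finset.card_range, nsmul_eq_mul] at h3
    rw [hA, Matrix.trace_smul, Matrix.trace_sum, smul_eq_mul]
    simp only [Matrix.trace_vecMulVec]
    calc _ ≤ lam⁻¹ * (m * L ^ 2) := by gcongr
      _ = _ := by ring
  rw [h1, Matrix.det_smul, Fintype.card_fin, mul_div_cancel_left₀ _ (by positivity)]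
  have h4 := (one_add_trace_le_det_one_add hAp).2
  rw [Fintype.card_fin] at h4
  refine h4.trans ?_
  have := hAp.trace_nonneg
  gcongr

theorem lam_mul_le_dotProduct_gram_mulVec (m : ℕ) (x : Fin d → ℝ) :
    lam * (x ⬝ᵥ x) ≤ x ⬝ᵥ (gram lam f m *ᵥ x) := by
  rw [gram, Matrix.add_mulVec, Matrix.smul_mulVec, Matrix.one_mulVec, dotProduct_add,
    dotProduct_smul, smul_eq_mul, le_add_iff_nonneg_right]
  refine dotProduct_mulVec_self_nonneg (Matrix.posSemidef_sum _ fun i _ => ?_) x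
  simpa using Matrix.posSemidef_vecMulVec_self_star (f i).ofLp

/-- The order reversal `V ≥ lam` implies `V⁻¹ ≤ 1 / lam`, read off from the square of `x - lam • y`
with `y = V⁻¹ x`. -/
theorem invForm_gram_le (hlam : 0 < lam) (m : ℕ) (x : Fin d → ℝ) :
    invForm (gram lam f m) x x ≤ (x ⬝ᵥ x) / lam := by
  set y := (gram lam f m)⁻¹ *ᵥ x with hy
  have h1 := lam_mul_le_dotProduct_gram_mulVec (lam := lam) f m y
  rw [hy, mulVec_inv_mulVec (gram_posDef f hlam m), ← hy] at h1
  have h2 : 0 ≤ (x - lam • y) ⬝ᵥ (x - lam • y) :=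
    Finset.sum_nonneg fun i _ => mul_self_nonneg _
  have h3 : invForm (gram lam f m) x x = x ⬝ᵥ y := rfl
  simp only [dotProduct_sub, sub_dotProduct, smul_dotProduct, dotProduct_smul, smul_eq_mul] at h2
  rw [dotProduct_comm y x] at h1 h2
  rw [h3, le_div_iff₀ hlam]
  nlinarith

end Gram

/-! ### Confidence ellipsoids and the consequence of optimism. -/

section Confidence

variable {d : ℕ} {lam : ℝ} (f : ℕ → Vec d)

theorem inner_eq_dotProduct (x y : Vec d) : ⟪x, y⟫_ℝ = x.ofLp ⬝ᵥ y.ofLp := by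
  rw [EuclideanSpace.inner_eq_star_dotProduct, dotProduct_comm]
  simp

/-- The noise `∑_{i < m} ξ_i f_i` accumulated by the least-squares estimate. -/
def noiseSum (ξ : ℕ → ℝ) (m : ℕ) : Fin d → ℝ := ∑ i ∈ Finset.range m, ξ i • (f i).ofLp

theorem gram_mulVec (m : ℕ) (x : Fin d → ℝ) :
    gram lam f m *ᵥ x
      = lam • x + ∑ i ∈ Finset.range m, ((f i).ofLp ⬝ᵥ x) • (f i).ofLp := by
  rw [gram, Matrix.add_mulVec, Matrix.smul_mulVec, Matrix.one_mulVec, Matrix.sum_mulVec]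
  congr 1
  refine Finset.sum_congr rfl fun i _ => ?_
  rw [Matrix.vecMulVec_mulVec]
  simp

/-- The normal equations: the data terms of `V w` and `V ẑ` cancel, and only the regularization bias
and the noise are left. -/
theorem gram_mulVec_error (hlam : 0 < lam) {r ξ : ℕ → ℝ} {w : Vec d} {m : ℕ}
    (hr : ∀ i < m, r i = ⟪f i, w⟫_ℝ + ξ i) :
    gram lam f m *ᵥ (w - lsEstimate lam f r m).ofLp = lam • w.ofLp - noiseSum f ξ m := by
  have h1 : (∑ i ∈ Finset.range m, r i • f i).ofLp
      = ∑ i ∈ Finset.range m, ((f i).ofLp ⬝ᵥ w.ofLp) • (f i).ofLp + noiseSum f ξ m := by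
    rw [WithLp.ofLp_sum, noiseSum, ← Finset.sum_add_distrib]
    refine Finset.sum_congr rfl fun i hi => ?_
    rw [WithLp.ofLp_smul, hr i (Finset.mem_range.1 hi), add_smul, inner_eq_dotProduct]
  rw [WithLp.ofLp_sub, Matrix.mulVec_sub, lsEstimate, WithLp.ofLp_toLp,
    mulVec_inv_mulVec (gram_posDef f hlam m), h1, gram_mulVec]
  abel

theorem wnorm_sq {V : Matrix (Fin d) (Fin d) ℝ} (hV : V.PosDef) (x : Vec d) :
    wnorm V x ^ 2 = x.ofLp ⬝ᵥ (V *ᵥ x.ofLp) :=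
  Real.sq_sqrt (dotProduct_mulVec_self_nonneg hV.posSemidef _)

/-- The `V`-norm of the error is the `V⁻¹`-norm of `lam • w - N`. The triangle inequality gives the
claim, since the bias has norm at most `√lam * S` by `V⁻¹ ≤ 1 / lam`; it is carried out below on
squares. -/
theorem wnorm_error_le (hlam : 0 < lam) {r ξ : ℕ → ℝ} {w : Vec d} {m : ℕ} {S R : ℝ}
    (hr : ∀ i < m, r i = ⟪f i, w⟫_ℝ + ξ i) (hw : ‖w‖ ≤ S) (hS : 0 ≤ S) (hR : 0 ≤ R)
    (hN : invForm (gram lam f m) (noiseSum f ξ m) (noiseSum f ξ m) ≤ R ^ 2) :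
    wnorm (gram lam f m) (w - lsEstimate lam f r m) ≤ √lam * S + R := by
  have hV := gram_posDef f hlam m
  have hsq := wnorm_sq hV (w - lsEstimate lam f r m)
  have herr := gram_mulVec_error f hlam hr
  set e := w - lsEstimate lam f r m
  set N := noiseSum f ξ m
  have he : e.ofLp = (gram lam f m)⁻¹ *ᵥ (lam • w.ofLp - N) := by
    rw [← herr, inv_mulVec_mulVec hV]
  have hexp : wnorm (gram lam f m) e ^ 2 = lam ^ 2 * invForm (gram lam f m) w.ofLp w.ofLp
      - 2 * lam * invForm (gram lam f m) w.ofLp N + invForm (gram lam f m) N N := by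
    have hc := invForm_comm hV N w.ofLp
    have h1 : wnorm (gram lam f m) e ^ 2
        = invForm (gram lam f m) (lam • w.ofLp - N) (lam • w.ofLp - N) := by
      rw [hsq, herr, he, dotProduct_comm]
      rfl
    rw [h1]
    simp only [invForm, Matrix.mulVec_sub, Matrix.mulVec_smul, dotProduct_sub, sub_dotProduct,
      smul_dotProduct, dotProduct_smul, smul_eq_mul] at hc ⊢
    rw [hc]
    ring
  have h1 : lam * invForm (gram lam f m) w.ofLp w.ofLp ≤ S ^ 2 := by
    have := invForm_gram_le f hlam m w.ofLp
    rw [le_div_iff₀ hlam] at this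
    linarith [dotProduct_self_le hw]
  have h2 := sq_invForm_le hV w.ofLp N
  have h0 := invForm_self_nonneg hV w.ofLp
  have h0' := invForm_self_nonneg hV N
  set p := invForm (gram lam f m) w.ofLp w.ofLp
  set q := invForm (gram lam f m) N N
  set c := invForm (gram lam f m) w.ofLp N
  have hl : √lam ^ 2 = lam := Real.sq_sqrt hlam.le
  have hl0 := Real.sqrt_nonneg lam
  -- The cross term, by Cauchy–Schwarz; one factor `√lam` pairs with the norm of `w`.
  have h3 : |√lam * c| ≤ S * R := by
    refine abs_le_of_sq_le_sq ?_ (by positivity)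
    calc (√lam * c) ^ 2 = lam * c ^ 2 := by rw [mul_pow, hl]
      _ ≤ lam * (p * q) := by gcongr
      _ = (lam * p) * q := by ring
      _ ≤ S ^ 2 * R ^ 2 := by gcongr
      _ = (S * R) ^ 2 := by ring
  have h4 : -(S * R) ≤ √lam * c := (abs_le.1 h3).1
  refine le_of_sq_le_sq ?_ (by positivity)
  rw [hexp]
  have h5 : -(2 * lam * c) ≤ 2 * √lam * (S * R) := by
    have : 2 * lam * c = 2 * √lam * (√lam * c) := by
      linear_combination (-2 * c) * hl
    rw [this]
    nlinarith
  have h6 : lam ^ 2 * p ≤ lam * S ^ 2 := by nlinarith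
  have h7 : (√lam * S + R) ^ 2 = lam * S ^ 2 + 2 * √lam * (S * R) + R ^ 2 := by
    rw [add_sq, mul_pow, hl]; ring
  rw [h7]
  linarith

theorem mem_confidenceSet (hlam : 0 < lam) {r ξ : ℕ → ℝ} {w : Vec d} {m : ℕ} {S σ δ : ℝ}
    (hr : ∀ i < m, r i = ⟪f i, w⟫_ℝ + ξ i) (hw : ‖w‖ ≤ S) (hS : 0 ≤ S) (hσ : 0 ≤ σ)
    (hN : invForm (gram lam f m) (noiseSum f ξ m) (noiseSum f ξ m)
      ≤ σ ^ 2 * (Real.log ((gram lam f m).det / lam ^ d) + 2 * Real.log (1 / δ))) :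
    w ∈ confidenceSet lam S σ δ f r m := by
  refine wnorm_error_le f hlam hr hw hS (by positivity) (hN.trans ?_)
  rw [mul_pow]
  gcongr
  -- No sign condition on the logarithms is needed: the squared root is the positive part of its
  -- argument, which is at least the argument.
  rw [Real.sq_sqrt']
  exact le_max_left _ _

theorem inner_le_of_mem_confidenceSet (hlam : 0 < lam) {r : ℕ → ℝ} {m : ℕ} {S σ δ : ℝ}
    {w : Vec d} (hw : w ∈ confidenceSet lam S σ δ f r m) (x : Vec d) :
    |⟪x, w⟫_ℝ - ⟪x, lsEstimate lam f r m⟫_ℝ|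
      ≤ radius lam S σ δ f m * √(invForm (gram lam f m) x.ofLp x.ofLp) := by
  have hV := gram_posDef f hlam m
  have hw' : wnorm (gram lam f m) (w - lsEstimate lam f r m) ≤ radius lam S σ δ f m := hw
  have h0 : 0 ≤ wnorm (gram lam f m) (w - lsEstimate lam f r m) := Real.sqrt_nonneg _
  rw [← inner_sub_right]
  refine abs_le_of_sq_le_sq ?_ (mul_nonneg (h0.trans hw') (Real.sqrt_nonneg _))
  rw [inner_eq_dotProduct, mul_pow, Real.sq_sqrt (invForm_self_nonneg hV _)]
  refine (sq_dotProduct_le_invForm_mul hV _ _).trans ?_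
  rw [← wnorm_sq hV, mul_comm]
  have := invForm_self_nonneg hV x.ofLp
  gcongr

/-- The instantaneous regret of an optimistic choice when the parameter lies in the confidence
ellipsoid. -/
theorem inner_sub_inner_le_of_ucb_le (hlam : 0 < lam) {r : ℕ → ℝ} {m : ℕ} {S σ δ : ℝ}
    {w : Vec d} (hw : w ∈ confidenceSet lam S σ δ f r m) {x y : Vec d}
    (hxy : ucb lam S σ δ f r m x ≤ ucb lam S σ δ f r m y) :
    ⟪x, w⟫_ℝ - ⟪y, w⟫_ℝ
      ≤ 2 * radius lam S σ δ f m * √(invForm (gram lam f m) y.ofLp y.ofLp) := by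
  -- Boundedness above is what makes the `sSup` in `ucb` a genuine supremum; the same bound
  -- estimates it from above.
  have hub : ∀ u : Vec d, ∀ v ∈ (fun w => ⟪u, w⟫_ℝ) '' confidenceSet lam S σ δ f r m,
      v ≤ ⟪u, lsEstimate lam f r m⟫_ℝ
        + radius lam S σ δ f m * √(invForm (gram lam f m) u.ofLp u.ofLp) := by
    rintro u _ ⟨v, hv, rfl⟩
    have := (abs_le.1 (inner_le_of_mem_confidenceSet f hlam hv u)).2
    simp only
    linarith
  have h1 : ⟪x, w⟫_ℝ ≤ ucb lam S σ δ f r m x := le_csSup ⟨_, hub x⟩ ⟨w, hw, rfl⟩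
  have h2 := csSup_le (Set.Nonempty.image _ ⟨w, hw⟩) (hub y)
  have h3 := (abs_le.1 (inner_le_of_mem_confidenceSet f hlam hw y)).1
  have h4 : ucb lam S σ δ f r m y ≤ _ := h2
  linarith

end Confidence

/-! ### Logarithmic inequalities and the elliptical potential. -/

section Potential

/-- Bernoulli's inequality with exponent `1 + c`. It moves the constant `L ^ 2 / lam` out of the
logarithm. -/
theorem log_one_add_mul_le {c x : ℝ} (hc : 0 ≤ c) (hx : 0 ≤ x) :
    Real.log (1 + c * x) ≤ (1 + c) * Real.log (1 + x) := by
  rw [← Real.log_rpow (by positivity)]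
  refine Real.log_le_log (by positivity) ?_
  have := one_add_mul_self_le_rpow_one_add (s := x) (by linarith) (p := 1 + c) (by linarith)
  linarith

/-- From `y / (1 + y) ≤ log (1 + y)`. A bounded quantity is thus controlled by the logarithm that
telescopes. -/
theorem le_mul_log_one_add {M y : ℝ} (hy : 0 ≤ y) (hyM : y ≤ M) :
    y ≤ (1 + M) * Real.log (1 + y) := by
  have h := Real.one_sub_inv_le_log_of_pos (x := 1 + y) (by positivity)
  have h1 : (1 + y) * (1 - (1 + y)⁻¹) = y := by field_simp; ring
  have h2 : 0 ≤ Real.log (1 + y) := Real.log_nonneg (by linarith)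
  nlinarith

variable {d : ℕ} {lam L : ℝ} (f : ℕ → Vec d)

theorem log_det_gram_le (hlam : 0 < lam) (hf : ∀ i, ‖f i‖ ≤ L) {m : ℕ} {N : ℝ} (hN : m ≤ N) :
    Real.log ((gram lam f m).det / lam ^ d) ≤ d * ((1 + L ^ 2 / lam) * Real.log (1 + N)) := by
  have hp := (gram_posDef f hlam m).det_pos
  have hm : (0 : ℝ) ≤ m := m.cast_nonneg
  refine (Real.log_le_log (by positivity) (det_gram_le f hlam hf m)).trans ?_
  rw [Real.log_pow]
  refine mul_le_mul_of_nonneg_left ?_ (Nat.cast_nonneg _)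
  refine le_trans ?_ (log_one_add_mul_le (by positivity) (hm.trans hN))
  refine Real.log_le_log (by positivity) ?_
  rw [mul_comm]
  gcongr

theorem geom_sum_le {γ : ℝ} (hγ₀ : 0 ≤ γ) (hγ₁ : γ < 1) (H : ℕ) :
    ∑ t ∈ Finset.range H, γ ^ t ≤ (1 - γ)⁻¹ := by
  rw [← tsum_geometric_of_lt_one hγ₀ hγ₁]
  exact (summable_geometric_of_lt_one hγ₀ hγ₁).sum_le_tsum _ fun i _ => by positivity

theorem invForm_feature_le (hlam : 0 < lam) (hf : ∀ i, ‖f i‖ ≤ L) (m i : ℕ) :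
    invForm (gram lam f m) (f i).ofLp (f i).ofLp ≤ L ^ 2 / lam := by
  refine (invForm_gram_le f hlam m _).trans ?_
  have := dotProduct_self_le (hf i)
  gcongr

/-- Without the discount this sum could be of order `H`; the geometric weights make the bound, and
hence the final constant, independent of the horizon. -/
theorem discounted_invForm_le (hlam : 0 < lam) (hf : ∀ i, ‖f i‖ ≤ L) {γ : ℝ} (hγ₀ : 0 ≤ γ)
    (hγ₁ : γ < 1) (H m : ℕ) :
    ∑ t ∈ Finset.range H, γ ^ t * invForm (gram lam f m) (f (m + t)).ofLp (f (m + t)).ofLp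
      ≤ (1 - γ)⁻¹ * (L ^ 2 / lam) := by
  refine le_trans ?_ (mul_le_mul_of_nonneg_right (geom_sum_le hγ₀ hγ₁ H) (by positivity))
  rw [Finset.sum_mul]
  gcongr with t
  exact invForm_feature_le f hlam hf _ _

/-- The elliptical potential bound for design matrices that are updated once per episode. -/
theorem sum_discounted_invForm_le (hlam : 0 < lam) (hf : ∀ i, ‖f i‖ ≤ L) {γ : ℝ} (hγ₀ : 0 ≤ γ)
    (hγ₁ : γ < 1) (H n : ℕ) :
    ∑ k ∈ Finset.range n, ∑ t ∈ Finset.range H,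
      γ ^ t * invForm (gram lam f (k * H)) (f (k * H + t)).ofLp (f (k * H + t)).ofLp
      ≤ (1 + (1 - γ)⁻¹ * (L ^ 2 / lam)) * Real.log ((gram lam f (n * H)).det / lam ^ d) := by
  have hg : 0 < 1 - γ := by linarith
  have hpos := fun m => (gram_posDef f hlam m).det_pos
  have hstep : ∀ k, ∑ t ∈ Finset.range H,
      γ ^ t * invForm (gram lam f (k * H)) (f (k * H + t)).ofLp (f (k * H + t)).ofLp
      ≤ (1 + (1 - γ)⁻¹ * (L ^ 2 / lam)) * (Real.log ((gram lam f ((k + 1) * H)).det)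
        - Real.log ((gram lam f (k * H)).det)) := by
    intro k
    have h0 := fun t => invForm_self_nonneg (gram_posDef f hlam (k * H)) (f (k * H + t)).ofLp
    have hy : 0 ≤ ∑ t ∈ Finset.range H,
        γ ^ t * invForm (gram lam f (k * H)) (f (k * H + t)).ofLp (f (k * H + t)).ofLp :=
      Finset.sum_nonneg fun t _ => mul_nonneg (by positivity) (h0 t)
    refine (le_mul_log_one_add hy (discounted_invForm_le f hlam hf hγ₀ hγ₁ H _)).trans ?_
    refine mul_le_mul_of_nonneg_left ?_ (by positivity)
    rw [← Real.log_div (hpos _).ne' (hpos _).ne']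
    refine Real.log_le_log (by positivity) ?_
    rw [le_div_iff₀ (hpos _), mul_comm, add_mul k 1 H, one_mul]
    refine le_trans ?_ (det_gram_add_ge f hlam (k * H) H)
    refine mul_le_mul_of_nonneg_left ?_ (hpos _).le
    gcongr with t
    -- The discount is dropped only here, inside the logarithm, where the determinant bound needs
    -- the full sum.
    exact mul_le_of_le_one_left (h0 t) (pow_le_one₀ hγ₀ hγ₁.le)
  refine (Finset.sum_le_sum fun k _ => hstep k).trans (le_of_eq ?_)
  rw [← Finset.mul_sum, Finset.sum_range_sub (fun k => Real.log ((gram lam f (k * H)).det)),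
    Real.log_div (hpos _).ne' (by positivity)]
  simp [gram]

end Potential

/-! ### The self-normalized process and coverage of the true parameter. -/

section SelfNormalized

/-- Completing the square: tilting by `exp (y ^ 2 / 2)` changes the variance `q / (1 + q) < 1` into
`q` and the mean into `b`. -/
theorem gaussianPDFReal_mul_exp_sq {q : ℝ≥0} (hq : q ≠ 0) (b y : ℝ) :
    gaussianPDFReal (b / (1 + q)) (q / (1 + q)) y * Real.exp (y ^ 2 / 2)
      = √(1 + q) * Real.exp (b ^ 2 / (2 * (1 + q))) * gaussianPDFReal b q y := by
  have hq' : (0 : ℝ) < q := by positivity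
  simp only [gaussianPDFReal, NNReal.coe_div, NNReal.coe_add, NNReal.coe_one]
  have h1 : (√(2 * Real.pi * (q / (1 + q))))⁻¹ = √(1 + q) * (√(2 * Real.pi * q))⁻¹ := by
    rw [← mul_div_assoc, Real.sqrt_div (by positivity), inv_div, div_eq_mul_inv]
  rw [h1, mul_assoc, ← Real.exp_add]
  have h2 : -(y - b / (1 + q)) ^ 2 / (2 * (q / (1 + q))) + y ^ 2 / 2
      = b ^ 2 / (2 * (1 + q)) + -(y - b) ^ 2 / (2 * q) := by
    field_simp
    ring
  rw [h2, Real.exp_add]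
  ring

theorem lintegral_exp_sq_gaussianReal {q : ℝ≥0} (hq : q ≠ 0) (b : ℝ) :
    ∫⁻ y, ENNReal.ofReal (Real.exp (y ^ 2 / 2)) ∂(gaussianReal (b / (1 + q)) (q / (1 + q)))
      = ENNReal.ofReal (√(1 + q) * Real.exp (b ^ 2 / (2 * (1 + q)))) := by
  have hc : q / (1 + q) ≠ 0 := by positivity
  rw [gaussianReal_of_var_ne_zero _ hc, lintegral_withDensity_eq_lintegral_mul _
    (measurable_gaussianPDF _ _) (by fun_prop)]
  have h : ∀ y, (gaussianPDF (b / (1 + q)) (q / (1 + q))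
      * fun y => ENNReal.ofReal (Real.exp (y ^ 2 / 2))) y
      = ENNReal.ofReal (√(1 + q) * Real.exp (b ^ 2 / (2 * (1 + q)))) * gaussianPDF b q y := by
    intro y
    rw [Pi.mul_apply, gaussianPDF, gaussianPDF, ← ENNReal.ofReal_mul (gaussianPDFReal_nonneg _ _ _),
      ← ENNReal.ofReal_mul (by positivity), gaussianPDFReal_mul_exp_sq hq]
  simp_rw [h]
  rw [lintegral_const_mul _ (measurable_gaussianPDF _ _), lintegral_gaussianPDF_eq_one _ hq, mul_one]

/-- The Gaussian mixture bound behind one step of the self-normalized supermartingale. -/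
theorem lintegral_exp_quadratic_le {ν : Measure ℝ} [IsProbabilityMeasure ν]
    (hν : ∀ y : ℝ, ∫⁻ x, ENNReal.ofReal (Real.exp (y * x)) ∂ν
      ≤ ENNReal.ofReal (Real.exp (y ^ 2 / 2))) {q : ℝ} (hq : 0 ≤ q) (b : ℝ) :
    ∫⁻ x, ENNReal.ofReal (Real.exp ((2 * x * b + x ^ 2 * q - b ^ 2) / (2 * (1 + q)))) ∂ν
      ≤ ENNReal.ofReal (√(1 + q)) := by
  rcases hq.eq_or_lt with rfl | hq
  -- For `q = 0` the mixing Gaussian is a point mass without a density, and the claim is the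
  -- subgaussian bound at `b` itself.
  · have h : ∀ x : ℝ, ENNReal.ofReal (Real.exp ((2 * x * b + x ^ 2 * 0 - b ^ 2) / (2 * (1 + 0))))
        = ENNReal.ofReal (Real.exp (-(b ^ 2 / 2))) * ENNReal.ofReal (Real.exp (b * x)) := by
      intro x
      rw [← ENNReal.ofReal_mul (by positivity), ← Real.exp_add]
      congr 2
      ring
    simp_rw [h]
    rw [lintegral_const_mul _ (by fun_prop)]
    refine (mul_le_mul_right (hν b) _).trans ?_
    rw [← ENNReal.ofReal_mul (by positivity), ← Real.exp_add]
    simp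
  lift q to ℝ≥0 using hq.le
  have hq0 : q ≠ 0 := by rintro rfl; simp at hq
  set G := gaussianReal (b / (1 + q)) (q / (1 + q))
  -- The part of the exponent that depends on `x` is the log-mgf of the Gaussian `G` at `x`. Writing
  -- it as an integral over `y` makes the exponent linear in `x`, so the subgaussian bound applies
  -- after Tonelli.
  have h : ∀ x : ℝ, ENNReal.ofReal (Real.exp ((2 * x * b + x ^ 2 * q - b ^ 2) / (2 * (1 + q))))
      = ENNReal.ofReal (Real.exp (-(b ^ 2 / (2 * (1 + q)))))
        * ∫⁻ y, ENNReal.ofReal (Real.exp (x * y)) ∂G := by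
    intro x
    rw [← ofReal_integral_eq_lintegral_ofReal (integrable_exp_mul_gaussianReal x)
      (Filter.Eventually.of_forall fun y => (Real.exp_pos _).le)]
    have hm := congrFun (mgf_id_gaussianReal (μ := b / (1 + q)) (v := q / (1 + q))) x
    simp only [mgf, id] at hm
    rw [hm, ← ENNReal.ofReal_mul (by positivity), ← Real.exp_add]
    congr 2
    push_cast
    field_simp
    ring
  simp_rw [h]
  rw [lintegral_const_mul _ (by fun_prop), lintegral_lintegral_swap (by fun_prop)]
  have h2 : ∫⁻ y, ∫⁻ x, ENNReal.ofReal (Real.exp (x * y)) ∂ν ∂G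
      ≤ ∫⁻ y, ENNReal.ofReal (Real.exp (y ^ 2 / 2)) ∂G := by
    refine lintegral_mono fun y => ?_
    simpa only [mul_comm] using hν y
  refine (mul_le_mul_right (h2.trans_eq (lintegral_exp_sq_gaussianReal hq0 b)) _).trans ?_
  rw [← ENNReal.ofReal_mul (by positivity), mul_left_comm, ← Real.exp_add]
  simp

variable {d : ℕ} {lam : ℝ}

/-- The self-normalized process `exp (‖N_m‖² / 2) √(lam^d / det V_m)`, with the noise `N_m`
measured in the inverse of the design matrix `V_m`. -/
noncomputable def selfNormalized (lam : ℝ) (f : ℕ → Vec d) (ξ : ℕ → ℝ) (m : ℕ) : ℝ :=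
  Real.exp (invForm (gram lam f m) (noiseSum f ξ m) (noiseSum f ξ m) / 2)
    * √(lam ^ d / (gram lam f m).det)

theorem noiseSum_succ (f : ℕ → Vec d) (ξ : ℕ → ℝ) (m : ℕ) :
    noiseSum f ξ (m + 1) = noiseSum f ξ m + ξ m • (f m).ofLp := by
  rw [noiseSum, Finset.sum_range_succ, noiseSum]

/-- Sherman–Morrison applied to `N + ξ f`. The increment has exactly the exponent of the Gaussian
mixture bound, with `q = ‖f‖²` and `b = ⟨f, N⟩` in the old inverse form. -/
theorem invForm_noiseSum_succ (hlam : 0 < lam) (f : ℕ → Vec d) (ξ : ℕ → ℝ) (m : ℕ) :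
    invForm (gram lam f (m + 1)) (noiseSum f ξ (m + 1)) (noiseSum f ξ (m + 1))
      = invForm (gram lam f m) (noiseSum f ξ m) (noiseSum f ξ m)
        + (2 * ξ m * invForm (gram lam f m) (f m).ofLp (noiseSum f ξ m)
          + ξ m ^ 2 * invForm (gram lam f m) (f m).ofLp (f m).ofLp
          - invForm (gram lam f m) (f m).ofLp (noiseSum f ξ m) ^ 2)
          / (1 + invForm (gram lam f m) (f m).ofLp (f m).ofLp) := by
  have hV := gram_posDef f hlam m
  have hq : 1 + invForm (gram lam f m) (f m).ofLp (f m).ofLp ≠ 0 := by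
    have := invForm_self_nonneg hV (f m).ofLp; positivity
  have hc := invForm_comm hV (noiseSum f ξ m) (f m).ofLp
  rw [noiseSum_succ, gram_succ, invForm, inv_add_vecMulVec_mulVec hV]
  simp only [invForm, Matrix.mulVec_add, Matrix.mulVec_smul, dotProduct_sub, dotProduct_add,
    add_dotProduct, smul_dotProduct, dotProduct_smul, smul_eq_mul] at hc hq ⊢
  rw [hc]
  field_simp
  ring

theorem selfNormalized_succ (hlam : 0 < lam) (f : ℕ → Vec d) (ξ : ℕ → ℝ) (m : ℕ) :
    selfNormalized lam f ξ (m + 1) = selfNormalized lam f ξ m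
      * ((√(1 + invForm (gram lam f m) (f m).ofLp (f m).ofLp))⁻¹
      * Real.exp ((2 * ξ m * invForm (gram lam f m) (f m).ofLp (noiseSum f ξ m)
          + ξ m ^ 2 * invForm (gram lam f m) (f m).ofLp (f m).ofLp
          - invForm (gram lam f m) (f m).ofLp (noiseSum f ξ m) ^ 2)
          / (2 * (1 + invForm (gram lam f m) (f m).ofLp (f m).ofLp)))) := by
  have hV := gram_posDef f hlam m
  have hdet := hV.det_pos
  rw [selfNormalized, invForm_noiseSum_succ hlam, add_div, Real.exp_add, gram_succ,
    det_add_vecMulVec hV, ← div_div (lam ^ d), Real.sqrt_div (by positivity), selfNormalized,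
    mul_comm (2 : ℝ) (1 + _), ← div_div _ (1 + _) (2 : ℝ)]
  ring

/-! ### Measurability, over an arbitrary σ-algebra so that it applies to `ℱ m`. -/

section Measurability

variable {α : Type*} [MeasurableSpace α]

theorem measurable_det_of_entries {ι : Type*} [Fintype ι] [DecidableEq ι]
    {V : α → Matrix ι ι ℝ} (hV : ∀ i j, Measurable fun ω => V ω i j) :
    Measurable fun ω => (V ω).det := by
  simp only [Matrix.det_apply']
  exact Finset.measurable_sum _ fun σ _ =>
    (Finset.measurable_prod _ fun i _ => hV _ _).const_mul _

theorem measurable_inv_entry {ι : Type*} [Fintype ι] [DecidableEq ι]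
    {V : α → Matrix ι ι ℝ} (hV : ∀ i j, Measurable fun ω => V ω i j) (i j : ι) :
    Measurable fun ω => (V ω)⁻¹ i j := by
  simp only [Matrix.inv_def, Matrix.smul_apply, smul_eq_mul, Ring.inverse_eq_inv',
    Matrix.adjugate_apply]
  refine (measurable_det_of_entries hV).inv.mul (measurable_det_of_entries fun k l => ?_)
  simp only [Matrix.updateRow_apply]
  split_ifs
  · exact measurable_const
  · exact hV k l

theorem measurable_invForm {ι : Type*} [Fintype ι] [DecidableEq ι] {V : α → Matrix ι ι ℝ}
    (hV : ∀ i j, Measurable fun ω => V ω i j) {x y : α → ι → ℝ}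
    (hx : ∀ i, Measurable fun ω => x ω i) (hy : ∀ i, Measurable fun ω => y ω i) :
    Measurable fun ω => invForm (V ω) (x ω) (y ω) := by
  simp only [invForm, dotProduct, Matrix.mulVec]
  exact Finset.measurable_sum _ fun i _ => (hx i).mul <|
    Finset.measurable_sum _ fun j _ => (measurable_inv_entry hV i j).mul (hy j)

theorem measurable_gram_entry {f : ℕ → α → Vec d} {m : ℕ} (hf : ∀ k < m, Measurable (f k))
    (i j : Fin d) : Measurable fun ω => gram lam (fun k => f k ω) m i j := by
  simp only [gram, Matrix.add_apply, Matrix.sum_apply, Matrix.vecMulVec_apply]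
  refine measurable_const.add (Finset.measurable_sum _ fun k hk => ?_)
  have := hf k (Finset.mem_range.1 hk)
  exact (by fun_prop : Measurable fun ω => f k ω i).mul (by fun_prop)

theorem measurable_noiseSum {f : ℕ → α → Vec d} {ξ : ℕ → α → ℝ} {m : ℕ}
    (hf : ∀ k < m, Measurable (f k)) (hξ : ∀ k < m, Measurable (ξ k)) (i : Fin d) :
    Measurable fun ω => noiseSum (fun k => f k ω) (fun k => ξ k ω) m i := by
  simp only [noiseSum, Finset.sum_apply, Pi.smul_apply, smul_eq_mul]
  refine Finset.measurable_sum _ fun k hk => ?_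
  have := hf k (Finset.mem_range.1 hk)
  exact (hξ k (Finset.mem_range.1 hk)).mul (by fun_prop)

theorem measurable_selfNormalized {f : ℕ → α → Vec d} {ξ : ℕ → α → ℝ} {m : ℕ}
    (hf : ∀ k < m, Measurable (f k)) (hξ : ∀ k < m, Measurable (ξ k)) :
    Measurable fun ω => selfNormalized lam (fun k => f k ω) (fun k => ξ k ω) m := by
  have h1 := measurable_invForm (measurable_gram_entry (lam := lam) hf)
    (measurable_noiseSum hf hξ) (measurable_noiseSum hf hξ)
  have h2 := measurable_det_of_entries (measurable_gram_entry (lam := lam) hf)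
  simp only [selfNormalized]
  exact (h1.div_const 2).exp.mul (h2.const_div _).sqrt

end Measurability

theorem lintegral_exp_mul_le {Ω : Type*} [MeasurableSpace Ω] {μ : Measure Ω} {η : Ω → ℝ}
    {c : ℝ≥0} (h : HasSubgaussianMGF η c μ) (y : ℝ) :
    ∫⁻ ω, ENNReal.ofReal (Real.exp (y * η ω)) ∂μ ≤ ENNReal.ofReal (Real.exp (c * y ^ 2 / 2)) := by
  rw [← ofReal_integral_eq_lintegral_ofReal (h.integrable_exp_mul y)
    (Filter.Eventually.of_forall fun _ => (Real.exp_pos _).le)]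
  exact ENNReal.ofReal_le_ofReal (h.mgf_le y)

/-- Freezing a variable independent of the past. -/
theorem lintegral_comp_indep {Ω E : Type*} [MeasurableSpace E] {m mΩ : MeasurableSpace Ω}
    {μ : Measure Ω} [IsProbabilityMeasure μ] (hm : m ≤ mΩ) {X : Ω → E} (hX : Measurable[m] X)
    {ξ : Ω → ℝ} (hξ : Measurable ξ)
    (hind : Indep (MeasurableSpace.comap ξ inferInstance) m μ) {g : E × ℝ → ℝ≥0∞}
    (hg : Measurable g) :
    ∫⁻ ω, g (X ω, ξ ω) ∂μ = ∫⁻ ω, ∫⁻ y, g (X ω, y) ∂(μ.map ξ) ∂μ := by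
  have hX' : Measurable X := hX.mono hm le_rfl
  have hi : IndepFun X ξ μ := by
    rw [IndepFun_iff_Indep]
    exact (indep_of_indep_of_le_right hind hX.comap_le).symm
  have hmap := (indepFun_iff_map_prod_eq_prod_map_map hX'.aemeasurable hξ.aemeasurable).1 hi
  have : IsProbabilityMeasure (μ.map ξ) := Measure.isProbabilityMeasure_map hξ.aemeasurable
  rw [← lintegral_map (f := g) hg (hX'.prodMk hξ), hmap, lintegral_prod _ hg.aemeasurable,
    lintegral_map hg.lintegral_prod_right' hX']

variable {Ω : Type*} [mΩ : MeasurableSpace Ω] {μ : Measure Ω} [IsProbabilityMeasure μ]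
  {ℱ : Filtration ℕ mΩ}

theorem lintegral_selfNormalized_le_one (hlam : 0 < lam) {f : ℕ → Ω → Vec d} {ξ : ℕ → Ω → ℝ}
    (hf : ∀ k, Measurable[ℱ k] (f k)) (hξ : ∀ k, Measurable[ℱ (k + 1)] (ξ k))
    (hind : ∀ k, Indep (MeasurableSpace.comap (ξ k) inferInstance) (ℱ k) μ)
    (hsub : ∀ k, ∀ y : ℝ, ∫⁻ ω, ENNReal.ofReal (Real.exp (y * ξ k ω)) ∂μ
      ≤ ENNReal.ofReal (Real.exp (y ^ 2 / 2))) (m : ℕ) :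
    ∫⁻ ω, ENNReal.ofReal (selfNormalized lam (fun k => f k ω) (fun k => ξ k ω) m) ∂μ ≤ 1 := by
  induction m with
  | zero =>
    have h : ∀ ω, selfNormalized lam (fun k => f k ω) (fun k => ξ k ω) 0 = 1 := by
      intro ω
      simp [selfNormalized, noiseSum, invForm, gram, hlam.ne']
    simp [h]
  | succ m ih =>
    have hfm : ∀ k < m, Measurable[ℱ m] (f k) := fun k hk =>
      (hf k).mono (ℱ.mono hk.le) le_rfl
    have hξm : ∀ k < m, Measurable[ℱ m] (ξ k) := fun k hk =>
      (hξ k).mono (ℱ.mono hk) le_rfl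
    have hfe : ∀ i, Measurable[ℱ m] fun ω => (f m ω).ofLp i := fun i =>
      (by fun_prop : Measurable fun x : Vec d => x.ofLp i).comp (hf m)
    have hξ' : Measurable (ξ m) := (hξ m).mono (ℱ.le _) le_rfl
    have hW : Measurable[ℱ m] fun ω => selfNormalized lam (fun k => f k ω) (fun k => ξ k ω) m :=
      @measurable_selfNormalized d lam Ω (ℱ m) f ξ m hfm hξm
    have hq : Measurable[ℱ m] fun ω =>
        invForm (gram lam (fun k => f k ω) m) (f m ω).ofLp (f m ω).ofLp :=
      @measurable_invForm Ω (ℱ m) _ _ _ _ (@measurable_gram_entry d lam Ω (ℱ m) f m hfm) _ _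
        hfe hfe
    have hb : Measurable[ℱ m] fun ω => invForm (gram lam (fun k => f k ω) m) (f m ω).ofLp
        (noiseSum (fun k => f k ω) (fun k => ξ k ω) m) :=
      @measurable_invForm Ω (ℱ m) _ _ _ _ (@measurable_gram_entry d lam Ω (ℱ m) f m hfm) _ _
        hfe (@measurable_noiseSum d Ω (ℱ m) f ξ m hfm hξm)
    have hX : Measurable[ℱ m] fun ω => (selfNormalized lam (fun k => f k ω) (fun k => ξ k ω) m,
        invForm (gram lam (fun k => f k ω) m) (f m ω).ofLp (f m ω).ofLp,
        invForm (gram lam (fun k => f k ω) m) (f m ω).ofLp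
          (noiseSum (fun k => f k ω) (fun k => ξ k ω) m)) :=
      hW.prodMk (hq.prodMk hb)
    -- The old value, `q` and `b` are known at time `m`, so they may be frozen while the independent
    -- `ξ m` is integrated out.
    have hfreeze := lintegral_comp_indep (ℱ.le m) hX hξ' (hind m)
      (g := fun p : (ℝ × ℝ × ℝ) × ℝ => ENNReal.ofReal (p.1.1 * ((√(1 + p.1.2.1))⁻¹
        * Real.exp ((2 * p.2 * p.1.2.2 + p.2 ^ 2 * p.1.2.1 - p.1.2.2 ^ 2)
          / (2 * (1 + p.1.2.1)))))) (by fun_prop)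
    have : IsProbabilityMeasure (μ.map (ξ m)) := Measure.isProbabilityMeasure_map hξ'.aemeasurable
    simp_rw [selfNormalized_succ hlam]
    refine (hfreeze.trans_le (lintegral_mono fun ω => ?_)).trans ih
    have hq0 := invForm_self_nonneg (gram_posDef (fun k => f k ω) hlam m) (f m ω).ofLp
    have hW0 : 0 ≤ selfNormalized lam (fun k => f k ω) (fun k => ξ k ω) m := by
      rw [selfNormalized]; positivity
    dsimp only
    set q := invForm (gram lam (fun k => f k ω) m) (f m ω).ofLp (f m ω).ofLp
    set W := selfNormalized lam (fun k => f k ω) (fun k => ξ k ω) m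
    simp_rw [← mul_assoc W,
      ENNReal.ofReal_mul (mul_nonneg hW0 (inv_nonneg.2 (Real.sqrt_nonneg (1 + q))))]
    rw [lintegral_const_mul _ (by fun_prop)]
    refine (mul_le_mul_right (lintegral_exp_quadratic_le ?_ hq0 _) _).trans ?_
    · intro y
      rw [lintegral_map (by fun_prop) hξ']
      exact hsub m y
    · rw [← ENNReal.ofReal_mul (by positivity), mul_assoc, inv_mul_cancel₀ (by positivity), mul_one]

/-- Taking logarithms; with `c = 1 / δ` this is the squared noise part of `radius` for `σ = 1`. -/
theorem invForm_noiseSum_le_of_selfNormalized_le (hlam : 0 < lam) {f : ℕ → Vec d} {ξ : ℕ → ℝ}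
    {m : ℕ} {c : ℝ} (h : selfNormalized lam f ξ m ≤ c) :
    invForm (gram lam f m) (noiseSum f ξ m) (noiseSum f ξ m)
      ≤ Real.log ((gram lam f m).det / lam ^ d) + 2 * Real.log c := by
  have hdet := (gram_posDef f hlam m).det_pos
  have h1 : 0 < selfNormalized lam f ξ m := by rw [selfNormalized]; positivity
  have h2 := Real.log_le_log h1 h
  rw [selfNormalized, Real.log_mul (Real.exp_pos _).ne' (by positivity), Real.log_exp,
    Real.log_sqrt (by positivity), ← inv_div (gram lam f m).det, Real.log_inv] at h2
  linarith

theorem invForm_noiseSum_smul (f : ℕ → Vec d) (ξ : ℕ → ℝ) (V : Matrix (Fin d) (Fin d) ℝ)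
    (c : ℝ) (m : ℕ) :
    invForm V (noiseSum f (fun k => c * ξ k) m) (noiseSum f (fun k => c * ξ k) m)
      = c ^ 2 * invForm V (noiseSum f ξ m) (noiseSum f ξ m) := by
  have : noiseSum f (fun k => c * ξ k) m = c • noiseSum f ξ m := by
    simp only [noiseSum, Finset.smul_sum, smul_smul]
  rw [this]
  simp only [invForm, Matrix.mulVec_smul, dotProduct_smul, smul_dotProduct, smul_eq_mul]
  ring

/-- The confidence ellipsoid after `m` steps contains the true parameter, except on an event of
probability at most `δ`. -/
theorem exists_confidence_failure_set (hlam : 0 < lam) {f : ℕ → Ω → Vec d} {η : ℕ → Ω → ℝ}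
    {σ : ℝ≥0} (hf : ∀ k, Measurable[ℱ k] (f k)) (hη : ∀ k, Measurable[ℱ (k + 1)] (η k))
    (hnoise : IsSubgaussianNoise μ ℱ σ η) {w : Vec d} {S : ℝ} (hS : 0 ≤ S) (hw : ‖w‖ ≤ S)
    {δ : ℝ} (hδ₀ : 0 < δ) (m : ℕ) :
    ∃ A, MeasurableSet A ∧ μ A ≤ ENNReal.ofReal δ ∧ ∀ ω ∉ A, w ∈ confidenceSet lam S σ δ
      (fun k => f k ω) (fun k => ⟪f k ω, w⟫_ℝ + η k ω) m := by
  rcases eq_or_ne σ 0 with rfl | hσ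
  -- For `σ = 0` the noise cannot be rescaled to unit variance proxy, but it vanishes almost surely;
  -- the failure set is a measurable null set.
  · have h0 : ∀ᵐ ω ∂μ, ∀ k, η k ω = 0 := by
      rw [ae_all_iff]
      intro k
      have := hnoise.subgaussian k
      simp only [ne_eq, OfNat.ofNat_ne_zero, not_false_eq_true, zero_pow] at this
      exact this.ae_eq_zero_of_hasSubgaussianMGF_zero
    refine ⟨toMeasurable μ {ω | ¬ ∀ k, η k ω = 0}, measurableSet_toMeasurable _ _, ?_, ?_⟩
    · rw [measure_toMeasurable, ae_iff.1 h0]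
      exact zero_le
    · intro ω hω
      have h1 : ∀ k, η k ω = 0 := by
        by_contra hc
        exact hω (subset_toMeasurable _ _ hc)
      refine mem_confidenceSet _ hlam (ξ := fun k => η k ω) (fun i _ => rfl) hw hS
        (NNReal.coe_nonneg _) ?_
      simp [noiseSum, h1, invForm]
  have hσ0 : (0 : ℝ) < σ := by positivity
  set ξ : ℕ → Ω → ℝ := fun k ω => (σ : ℝ)⁻¹ * η k ω with hξdef
  have hξm : ∀ k, Measurable[ℱ (k + 1)] (ξ k) := fun k => (hη k).const_mul _
  have hW := lintegral_selfNormalized_le_one (μ := μ) hlam hf hξm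
    (fun k => indep_of_indep_of_le_left (hnoise.indep k) (by
      rintro _ ⟨D, hD, rfl⟩
      exact ⟨(fun x => (σ : ℝ)⁻¹ * x) ⁻¹' D, (measurable_const_mul _) hD, rfl⟩))
    (fun k y => by
      have h := lintegral_exp_mul_le (hnoise.subgaussian k) (y * (σ : ℝ)⁻¹)
      simp only [hξdef, ← mul_assoc]
      refine h.trans_eq ?_
      congr 2
      push_cast
      field_simp) m
  have hmeas : Measurable fun ω =>
      selfNormalized lam (fun k => f k ω) (fun k => ξ k ω) m :=
    measurable_selfNormalized (fun k _ => (hf k).mono (ℱ.le _) le_rfl)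
      (fun k _ => (hξm k).mono (ℱ.le _) le_rfl)
  -- The failure event is that the process, of mean at most 1, reaches `1 / δ`; Markov's inequality
  -- bounds it by `δ`.
  refine ⟨{ω | ENNReal.ofReal (1 / δ) ≤
    ENNReal.ofReal (selfNormalized lam (fun k => f k ω) (fun k => ξ k ω) m)},
    measurableSet_le measurable_const hmeas.ennreal_ofReal, ?_, ?_⟩
  · refine (meas_ge_le_lintegral_div hmeas.ennreal_ofReal.aemeasurable ?_
      ENNReal.ofReal_ne_top).trans ?_
    · simpa using hδ₀
    · refine (ENNReal.div_le_div_right hW _).trans ?_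
      rw [one_div, one_div, ENNReal.ofReal_inv_of_pos hδ₀, inv_inv]
  · intro ω hω
    refine mem_confidenceSet _ hlam (ξ := fun k => η k ω) (fun i _ => rfl) hw hS
      (NNReal.coe_nonneg _) ?_
    have h1 : selfNormalized lam (fun k => f k ω) (fun k => ξ k ω) m ≤ 1 / δ := by
      by_contra hc
      exact hω (ENNReal.ofReal_le_ofReal (not_le.1 hc).le)
    have h2 := invForm_noiseSum_le_of_selfNormalized_le hlam h1
    rw [invForm_noiseSum_smul (ξ := fun k => η k ω)] at h2
    rw [inv_pow, inv_mul_le_iff₀ (by positivity)] at h2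
    exact h2

end SelfNormalized

/-! ### State laws under a policy and successor features as their integrals. -/

section Dynamics

variable {St Ac : Type*} [MeasurableSpace St] [MeasurableSpace Ac] {d : ℕ} {Z : Set (Vec d)}

/-- One step of the state process under the policy `π_z`. -/
noncomputable def stateStep (M : MDP St Ac) (B : BFM Z St Ac) : Kernel (Z × St) St :=
  M.P ∘ₖ (Kernel.deterministic Prod.snd measurable_snd ×ₖ B.π)

instance (M : MDP St Ac) (B : BFM Z St Ac) : IsMarkovKernel (stateStep M B) := by
  unfold stateStep; infer_instance

/-- The law of the state `t` steps after the start in `s` of a rollout of `π_z`. -/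
noncomputable def stateLaw (M : MDP St Ac) (B : BFM Z St Ac) : ℕ → Kernel (Z × St) St
  | 0 => Kernel.deterministic Prod.snd measurable_snd
  | t + 1 => stateStep M B ∘ₖ (Kernel.deterministic Prod.fst measurable_fst ×ₖ stateLaw M B t)

instance isMarkovKernel_stateLaw (M : MDP St Ac) (B : BFM Z St Ac) (t : ℕ) :
    IsMarkovKernel (stateLaw M B t) := by
  induction t with
  | zero => unfold stateLaw; infer_instance
  | succ t ih => unfold stateLaw; infer_instance

theorem lintegral_stateStep (M : MDP St Ac) (B : BFM Z St Ac) {g : St → ℝ≥0∞}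
    (hg : Measurable g) (x : Z × St) :
    ∫⁻ s', g s' ∂(stateStep M B x) = ∫⁻ a, ∫⁻ s', g s' ∂(M.P (x.2, a)) ∂(B.π x) := by
  rw [stateStep, Kernel.lintegral_comp _ _ _ hg, Kernel.prod_apply, Kernel.deterministic_apply,
    Measure.dirac_prod, lintegral_map hg.lintegral_kernel (by fun_prop)]

theorem lintegral_stateLaw_succ (M : MDP St Ac) (B : BFM Z St Ac) (t : ℕ) {g : St → ℝ≥0∞}
    (hg : Measurable g) (x : Z × St) :
    ∫⁻ s', g s' ∂(stateLaw M B (t + 1) x)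
      = ∫⁻ s₁, ∫⁻ s', g s' ∂(stateStep M B (x.1, s₁)) ∂(stateLaw M B t x) := by
  rw [stateLaw, Kernel.lintegral_comp _ _ _ hg, Kernel.prod_apply, Kernel.deterministic_apply,
    Measure.dirac_prod, lintegral_map hg.lintegral_kernel (by fun_prop)]

/-- The law of the rollout as a kernel in the first state and action. -/
noncomputable def rolloutKernel (M : MDP St Ac) (p : Kernel St Ac) :
    ℕ → Kernel (St × Ac) (St × Ac)
  | 0 => Kernel.id
  | t + 1 => (M.P ∘ₖ rolloutKernel M p t) ⊗ₖ Kernel.prodMkLeft (St × Ac) p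

instance isMarkovKernel_rolloutKernel (M : MDP St Ac) (p : Kernel St Ac) [IsMarkovKernel p]
    (t : ℕ) : IsMarkovKernel (rolloutKernel M p t) := by
  induction t with
  | zero => unfold rolloutKernel; infer_instance
  | succ t ih => unfold rolloutKernel; infer_instance

instance (B : BFM Z St Ac) (z : Z) : IsMarkovKernel (B.policy z) := by
  unfold BFM.policy; infer_instance

theorem rolloutKernel_apply (M : MDP St Ac) (p : Kernel St Ac) [IsMarkovKernel p] (s : St)
    (a : Ac) (t : ℕ) : rolloutKernel M p t (s, a) = rolloutLaw M p s a t := by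
  induction t with
  | zero => rw [rolloutKernel, rolloutLaw, Kernel.id_apply]
  | succ t ih =>
    rw [rolloutKernel, rolloutLaw, Kernel.compProd_apply_eq_compProd_sectR, Kernel.comp_apply, ih]
    rfl

theorem lintegral_rolloutKernel_succ (M : MDP St Ac) (p : Kernel St Ac) [IsMarkovKernel p]
    (t : ℕ) {g : St × Ac → ℝ≥0∞} (hg : Measurable g) (x : St × Ac) :
    ∫⁻ y, g y ∂(rolloutKernel M p (t + 1) x)
      = ∫⁻ y, ∫⁻ s', ∫⁻ a', g (s', a') ∂(p s') ∂(M.P y) ∂(rolloutKernel M p t x) := by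
  rw [rolloutKernel, Kernel.lintegral_compProd _ _ _ hg, Kernel.lintegral_comp]
  · rfl
  · exact (Measurable.lintegral_kernel_prod_right' (κ := p) hg)

/-- Averaging the first action over the policy makes it like every later one: the state follows
`stateLaw` and the action is a fresh draw from the policy. The induction varies `g`, because one
step back replaces `g` by its conditional mean. -/
theorem lintegral_rolloutKernel (M : MDP St Ac) (B : BFM Z St Ac) (z : Z) (s : St) (t : ℕ)
    {g : St × Ac → ℝ≥0∞} (hg : Measurable g) :
    ∫⁻ a, ∫⁻ y, g y ∂(rolloutKernel M (B.policy z) t (s, a)) ∂(B.π (z, s))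
      = ∫⁻ s', ∫⁻ a', g (s', a') ∂(B.π (z, s')) ∂(stateLaw M B t (z, s)) := by
  induction t generalizing g with
  | zero =>
    have h1 : Measurable fun s' => ∫⁻ a', g (s', a') ∂(B.π (z, s')) :=
      Measurable.lintegral_kernel_prod_right' (κ := B.policy z) hg
    simp only [rolloutKernel, stateLaw, Kernel.id_apply, Kernel.deterministic_apply]
    rw [lintegral_dirac' _ h1]
    exact lintegral_congr fun a => lintegral_dirac' _ hg
  | succ t ih =>
    have h1 : Measurable fun s' => ∫⁻ a', g (s', a') ∂(B.π (z, s')) :=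
      Measurable.lintegral_kernel_prod_right' (κ := B.policy z) hg
    simp_rw [lintegral_rolloutKernel_succ M (B.policy z) t hg]
    rw [ih (g := fun y => ∫⁻ s', ∫⁻ a', g (s', a') ∂(B.policy z s') ∂(M.P y))
      h1.lintegral_kernel, lintegral_stateLaw_succ M B t h1]
    refine lintegral_congr fun s₁ => ?_
    rw [lintegral_stateStep M B h1]
    rfl

theorem bind_rolloutKernel_fst (M : MDP St Ac) (B : BFM Z St Ac) (z : Z) (s : St) (t : ℕ) :
    ((((rolloutKernel M (B.policy z) t).map Prod.fst).comap (fun a => (s, a)) (by fun_prop))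
      ∘ₖ (Kernel.const Unit (B.π (z, s)))) () = stateLaw M B t (z, s) := by
  refine Measure.ext_of_lintegral _ fun g hg => ?_
  rw [Kernel.lintegral_comp _ _ _ hg, Kernel.const_apply]
  have h := lintegral_rolloutKernel M B z s t (g := fun x => g x.1) (by fun_prop)
  simp only [lintegral_const, measure_univ, mul_one] at h
  rw [← h]
  refine lintegral_congr fun a => ?_
  rw [Kernel.comap_apply, Kernel.map_apply _ measurable_fst, lintegral_map hg measurable_fst]

theorem integrable_of_norm_le {α E : Type*} [MeasurableSpace α] [NormedAddCommGroup E]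
    {ν : Measure α} [IsFiniteMeasure ν] {f : α → E} (hf : AEStronglyMeasurable f ν) {R : ℝ}
    (hR : ∀ x, ‖f x‖ ≤ R) : Integrable f ν :=
  Integrable.of_bound hf R (Filter.Eventually.of_forall hR)

theorem integral_rolloutLaw (M : MDP St Ac) (B : BFM Z St Ac) {L : ℝ} (hφ : ∀ x, ‖B.φ x‖ ≤ L)
    (z : Z) (s : St) (t : ℕ) :
    ∫ a, ∫ x, B.φ x.1 ∂(rolloutLaw M (B.policy z) s a t) ∂(B.π (z, s))
      = ∫ s', B.φ s' ∂(stateLaw M B t (z, s)) := by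
  have hm := B.φ_measurable
  rw [← bind_rolloutKernel_fst, Kernel.integral_comp]
  · rw [Kernel.const_apply]
    refine integral_congr_ae (Filter.Eventually.of_forall fun a => ?_)
    simp only
    rw [Kernel.comap_apply, Kernel.map_apply _ measurable_fst, rolloutKernel_apply,
      integral_map measurable_fst.aemeasurable hm.aestronglyMeasurable]
  · rw [bind_rolloutKernel_fst]
    exact integrable_of_norm_le hm.aestronglyMeasurable hφ

theorem BFM.IsPerfectUSF.ψState_eq {M : MDP St Ac} {B : BFM Z St Ac} {γ : ℝ} {H : ℕ}
    (hB : B.IsPerfectUSF M γ H) {L : ℝ} (hφ : ∀ x, ‖B.φ x‖ ≤ L) (s : St) (z : Z) :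
    B.ψState s z = ∑ t ∈ Finset.range H, γ ^ t • ∫ s', B.φ s' ∂(stateLaw M B t (z, s)) := by
  have hm := B.φ_measurable
  simp only [BFM.ψState, hB.exact, successorFeatures]
  rw [integral_finsetSum]
  · refine Finset.sum_congr rfl fun t _ => ?_
    rw [integral_smul, integral_rolloutLaw M B hφ]
  · intro t _
    refine Integrable.smul (γ ^ t) (integrable_of_norm_le (ν := B.π (z, s)) (R := L)
      (f := fun a => ∫ x, B.φ x.1 ∂(rolloutLaw M (B.policy z) s a t)) ?_ fun a => ?_)
    · simp_rw [← rolloutKernel_apply]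
      have h : StronglyMeasurable fun x : St × Ac => B.φ x.1 :=
        (hm.comp measurable_fst).stronglyMeasurable
      exact ((h.integral_kernel (κ := rolloutKernel M (B.policy z) t)).comp_measurable
        (measurable_prodMk_left (x := s))).aestronglyMeasurable
    · rw [← rolloutKernel_apply]
      have h := norm_integral_le_of_norm_le_const
        (μ := rolloutKernel M (B.policy z) t (s, a)) (f := fun x => B.φ x.1) (C := L)
        (Filter.Eventually.of_forall fun x => hφ x.1)
      rwa [probReal_univ, mul_one] at h

/-- A `BFM` does not require `ψ` to be measurable; joint measurability comes from exactness, through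
integrals against kernels. -/
theorem BFM.IsPerfectUSF.measurable_ψState {M : MDP St Ac} {B : BFM Z St Ac} {γ : ℝ} {H : ℕ}
    (hB : B.IsPerfectUSF M γ H) {L : ℝ} (hφ : ∀ x, ‖B.φ x‖ ≤ L) :
    Measurable fun x : Z × St => B.ψState x.2 x.1 := by
  simp only [hB.ψState_eq hφ]
  refine Finset.measurable_sum _ fun t _ => ?_
  exact (B.φ_measurable.stronglyMeasurable.integral_kernel
    (κ := stateLaw M B t)).measurable.const_smul (γ ^ t)

theorem BFM.IsPerfectUSF.norm_ψState_le {M : MDP St Ac} {B : BFM Z St Ac} {γ : ℝ} {H : ℕ}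
    (hB : B.IsPerfectUSF M γ H) {L : ℝ} (hL : 0 ≤ L) (hφ : ∀ x, ‖B.φ x‖ ≤ L) (hγ₀ : 0 ≤ γ)
    (hγ₁ : γ < 1) (s : St) (z : Z) : ‖B.ψState s z‖ ≤ (1 - γ)⁻¹ * L := by
  rw [hB.ψState_eq hφ]
  refine (norm_sum_le _ _).trans ?_
  refine le_trans ?_ (mul_le_mul_of_nonneg_right (geom_sum_le hγ₀ hγ₁ H) hL)
  rw [Finset.sum_mul]
  refine Finset.sum_le_sum fun t _ => ?_
  rw [norm_smul, Real.norm_of_nonneg (pow_nonneg hγ₀ t)]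
  refine mul_le_mul_of_nonneg_left ?_ (pow_nonneg hγ₀ t)
  refine (norm_integral_le_of_norm_le_const (Filter.Eventually.of_forall fun x => hφ x)).trans ?_
  simp

theorem BFM.IsPerfectUSF.inner_ψState {M : MDP St Ac} {B : BFM Z St Ac} {γ : ℝ} {H : ℕ}
    (hB : B.IsPerfectUSF M γ H) {L : ℝ} (hφ : ∀ x, ‖B.φ x‖ ≤ L) (s : St) (z : Z) (v : Vec d) :
    ⟪B.ψState s z, v⟫_ℝ
      = ∑ t ∈ Finset.range H, γ ^ t * ∫ s', ⟪B.φ s', v⟫_ℝ ∂(stateLaw M B t (z, s)) := by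
  rw [hB.ψState_eq hφ, sum_inner]
  refine Finset.sum_congr rfl fun t _ => ?_
  rw [real_inner_smul_left, real_inner_comm, ← integral_inner]
  · simp_rw [real_inner_comm v]
  · exact integrable_of_norm_le B.φ_measurable.aestronglyMeasurable hφ

end Dynamics

/-! ### Conditional laws along an episode. -/

section Interaction

/-- Integration of a function of the past and of a variable with known conditional law. -/
theorem lintegral_of_condLaw {Ω E β : Type*} [MeasurableSpace E] [MeasurableSpace β]
    {m mΩ : MeasurableSpace Ω} {μ : Measure Ω} [IsProbabilityMeasure μ] (hm : m ≤ mΩ)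
    {X : Ω → E} (hX : Measurable[m] X) {Y : Ω → β} (hY : Measurable Y) {κ : Kernel E β}
    [IsMarkovKernel κ] (h : HasCondLaw μ m Y fun ω => κ (X ω)) {g : E × β → ℝ≥0∞}
    (hg : Measurable g) :
    ∫⁻ ω, g (X ω, Y ω) ∂μ = ∫⁻ ω, ∫⁻ y, g (X ω, y) ∂(κ (X ω)) ∂μ := by
  have hX' : Measurable X := hX.mono hm le_rfl
  have : IsProbabilityMeasure (μ.map X) := Measure.isProbabilityMeasure_map hX'.aemeasurable
  -- The conditional law tested on rectangles determines the joint law of `X` and `Y`.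
  have hmap : (μ.map X) ⊗ₘ κ = μ.map fun ω => (X ω, Y ω) := by
    refine Measure.ext_prod fun {C D} hC hD => ?_
    rw [Measure.compProd_apply_prod hC hD, Measure.map_apply (hX'.prodMk hY) (hC.prod hD),
      setLIntegral_map hC (κ.measurable_coe hD) hX', ← h _ (hX hC) _ hD]
    rfl
  rw [← lintegral_map (f := g) hg (hX'.prodMk hY), ← hmap, Measure.lintegral_compProd hg,
    lintegral_map (Measurable.lintegral_kernel_prod_right' hg) hX']

variable {Ω : Type*} [mΩ : MeasurableSpace Ω] {μ : Measure Ω}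
  {St Ac : Type*} [MeasurableSpace St] [MeasurableSpace Ac] {d : ℕ} {Z : Set (Vec d)}
  {M : MDP St Ac} {B : BFM Z St Ac} {H : ℕ} {ℱ : Filtration ℕ mΩ} {z : ℕ → Ω → Z}
  {s : ℕ → Ω → St} {a : ℕ → Ω → Ac} {η : ℕ → Ω → ℝ}

instance isMarkovKernel_nextState (M : MDP St Ac) (H τ : ℕ) (x : St) :
    IsMarkovKernel (nextState M H τ x) := by
  unfold nextState; split_ifs <;> infer_instance

theorem IsInteraction.measurable_state (h : IsInteraction μ M B H ℱ z s a η) (τ : ℕ) :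
    Measurable (s τ) := (h.state_measurable τ).mono (ℱ.le _) le_rfl

theorem IsInteraction.measurable_embedding (h : IsInteraction μ M B H ℱ z s a η) (k : ℕ) :
    Measurable (z k) := (h.embedding_measurable k).mono (ℱ.le _) le_rfl

theorem IsInteraction.condLaw_state (h : IsInteraction μ M B H ℱ z s a η) (τ : ℕ) :
    HasCondLaw μ (ℱ τ) (s (τ + 1)) fun ω =>
      (B.π (z (τ / H) ω, s τ ω)).bind (nextState M H τ (s τ ω)) := by
  intro C hC D hD
  have h1 := h.step τ C hC (Set.univ ×ˢ D) (MeasurableSet.univ.prod hD)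
  have h2 : (fun ω => (a τ ω, s (τ + 1) ω)) ⁻¹' (Set.univ ×ˢ D) = s (τ + 1) ⁻¹' D := by
    ext; simp
  rw [h2] at h1
  rw [h1]
  refine lintegral_congr fun ω => ?_
  rw [Measure.compProd_apply_prod MeasurableSet.univ hD, Measure.restrict_univ,
    Measure.bind_apply hD (Kernel.aemeasurable _)]

theorem IsInteraction.condLaw_state_within (h : IsInteraction μ M B H ℱ z s a η) {k t : ℕ}
    (ht : t + 1 < H) :
    HasCondLaw μ (ℱ (k * H + t)) (s (k * H + t + 1)) fun ω =>
      stateStep M B (z k ω, s (k * H + t) ω) := by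
  have h1 : (k * H + t) / H = k := by
    rw [mul_comm, Nat.mul_add_div (by omega), Nat.div_eq_of_lt (by omega), add_zero]
  -- Since `t + 1 < H`, this transition does not cross into the next episode, so `nextState` is the
  -- MDP transition.
  have h2 : ¬ H ∣ k * H + t + 1 := by
    rw [add_assoc, Nat.dvd_add_right (Dvd.intro_left k rfl)]
    exact fun hd => absurd (Nat.le_of_dvd (by omega) hd) (by omega)
  convert h.condLaw_state (k * H + t) using 2 with ω
  rw [h1, nextState, if_neg h2]
  refine Measure.ext_of_lintegral _ fun g hg => ?_
  rw [lintegral_stateStep M B hg, Measure.lintegral_bind (Kernel.aemeasurable _) hg.aemeasurable]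
  rfl

variable [IsProbabilityMeasure μ]

/-- For `k > 0` the preceding transition is a reset, which draws from `μ₀` whatever the past. This
makes the initial states of the two interactions comparable. -/
theorem IsInteraction.map_state_start (h : IsInteraction μ M B H ℱ z s a η) (hH : 0 < H)
    (k : ℕ) : μ.map (s (k * H)) = M.μ₀ := by
  cases k with
  | zero => simpa using h.init
  | succ k =>
    obtain ⟨τ, hτ⟩ : ∃ τ, (k + 1) * H = τ + 1 :=
      ⟨(k + 1) * H - 1, (Nat.sub_add_cancel (Nat.mul_pos k.succ_pos hH)).symm⟩
    rw [hτ]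
    ext D hD
    have h1 := h.condLaw_state τ Set.univ MeasurableSet.univ D hD
    have h2 : H ∣ τ + 1 := hτ ▸ Dvd.intro_left _ rfl
    rw [Measure.map_apply (h.measurable_state _) hD]
    simpa [nextState, if_pos h2] using h1

/-- The conditional law of the states within an episode, given its start. -/
theorem IsInteraction.lintegral_state (h : IsInteraction μ M B H ℱ z s a η) {E : Type*}
    [MeasurableSpace E] {k : ℕ} {X : Ω → E} (hX : Measurable[ℱ (k * H)] X) {t : ℕ} (ht : t < H)
    {g : E × Z × St → ℝ≥0∞} (hg : Measurable g) :
    ∫⁻ ω, g (X ω, z k ω, s (k * H + t) ω) ∂μ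
      = ∫⁻ ω, ∫⁻ s', g (X ω, z k ω, s') ∂(stateLaw M B t (z k ω, s (k * H) ω)) ∂μ := by
  induction t generalizing g with
  | zero =>
    refine lintegral_congr fun ω => ?_
    rw [stateLaw, Kernel.deterministic_apply, lintegral_dirac' _ (by fun_prop), add_zero]
  | succ t ih =>
    have hle : k * H ≤ k * H + t := Nat.le_add_right _ _
    have hW : Measurable[ℱ (k * H + t)] fun ω => ((X ω, z k ω), s (k * H + t) ω) :=
      ((hX.mono (ℱ.mono hle) le_rfl).prodMk
        ((h.embedding_measurable k).mono (ℱ.mono hle) le_rfl)).prodMk (h.state_measurable _)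
    have hκ : Measurable fun x : (E × Z) × St => (x.1.2, x.2) := by fun_prop
    have h1 := lintegral_of_condLaw (ℱ.le _) hW (h.measurable_state (k * H + t + 1))
      (κ := (stateStep M B).comap _ hκ) (h.condLaw_state_within ht)
      (g := fun p => g (p.1.1.1, p.1.1.2, p.2)) (by fun_prop)
    have hg' : Measurable fun p : E × Z × St =>
        ∫⁻ s', g (p.1, p.2.1, s') ∂(stateStep M B p.2) := by
      have hg2 : Measurable fun q : (E × Z × St) × St => g (q.1.1, q.1.2.1, q.2) := by fun_prop
      exact hg2.lintegral_kernel_prod_right'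
        (κ := (stateStep M B).comap (fun p : E × Z × St => p.2) (by fun_prop))
    rw [← add_assoc]
    refine h1.trans ?_
    refine (ih (by omega) hg').trans ?_
    refine lintegral_congr fun ω => ?_
    rw [lintegral_stateLaw_succ M B t (by fun_prop)]

/-- The joint law of a variable known at the start of an episode and a later state. -/
theorem IsInteraction.map_prod_state (h : IsInteraction μ M B H ℱ z s a η) {E : Type*}
    [MeasurableSpace E] {k : ℕ} {X : Ω → E} (hX : Measurable[ℱ (k * H)] X) {t : ℕ} (ht : t < H) :
    μ.map (fun ω => ((X ω, z k ω, s (k * H) ω), s (k * H + t) ω))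
      = (μ.map fun ω => (X ω, z k ω, s (k * H) ω)) ⊗ₘ Kernel.prodMkLeft E (stateLaw M B t) := by
  have hX' : Measurable X := hX.mono (ℱ.le _) le_rfl
  have h1 := h.measurable_state (k * H)
  have h2 := h.measurable_state (k * H + t)
  have h3 := h.measurable_embedding k
  have hp : Measurable fun ω => (X ω, z k ω, s (k * H) ω) := hX'.prodMk (h3.prodMk h1)
  refine Measure.ext_of_lintegral _ fun g hg => ?_
  rw [lintegral_map hg (hp.prodMk h2), Measure.lintegral_compProd hg,
    lintegral_map (Measurable.lintegral_kernel_prod_right' hg) hp]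
  exact h.lintegral_state (hX.prodMk (h.state_measurable (k * H))) ht
    (g := fun p => g ((p.1.1, p.2.1, p.1.2), p.2.2)) (by fun_prop)

/-- The successor features are the conditional expectation of the discounted feature sum of
an episode, given the information at its start. -/
theorem IsInteraction.integral_inner_ψState (h : IsInteraction μ M B H ℱ z s a η) {γ L R : ℝ}
    (hB : B.IsPerfectUSF M γ H) (hφ : ∀ x, ‖B.φ x‖ ≤ L) {k : ℕ} {v : Ω → Vec d}
    (hv : Measurable[ℱ (k * H)] v) (hvR : ∀ ω, ‖v ω‖ ≤ R) :
    ∫ ω, ⟪B.ψState (s (k * H) ω) (z k ω), v ω⟫_ℝ ∂μ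
      = ∑ t ∈ Finset.range H, γ ^ t * ∫ ω, ⟪B.φ (s (k * H + t) ω), v ω⟫_ℝ ∂μ := by
  have hm := B.φ_measurable
  have hv' : Measurable v := hv.mono (ℱ.le _) le_rfl
  have h1 := h.measurable_state (k * H)
  have h3 := h.measurable_embedding k
  have hp : Measurable fun ω => (v ω, z k ω, s (k * H) ω) := hv'.prodMk (h3.prodMk h1)
  have hbd : ∀ (x : St) ω, ‖⟪B.φ x, v ω⟫_ℝ‖ ≤ L * R := fun x ω =>
    (norm_inner_le_norm _ _).trans (mul_le_mul (hφ x) (hvR ω) (norm_nonneg _)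
      ((norm_nonneg _).trans (hφ x)))
  have hG : Measurable fun p : (Vec d × Z × St) × St => ⟪B.φ p.2, p.1.1⟫_ℝ :=
    (hm.comp measurable_snd).inner (measurable_fst.comp measurable_fst)
  have hcond : ∀ t < H, Integrable (fun ω => ∫ s', ⟪B.φ s', v ω⟫_ℝ
        ∂(stateLaw M B t (z k ω, s (k * H) ω))) μ ∧
      ∫ ω, ∫ s', ⟪B.φ s', v ω⟫_ℝ ∂(stateLaw M B t (z k ω, s (k * H) ω)) ∂μ
        = ∫ ω, ⟪B.φ (s (k * H + t) ω), v ω⟫_ℝ ∂μ := by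
    intro t ht
    have h2 := h.measurable_state (k * H + t)
    have hmap := h.map_prod_state hv ht
    have : IsProbabilityMeasure (μ.map fun ω => (v ω, z k ω, s (k * H) ω)) :=
      Measure.isProbabilityMeasure_map hp.aemeasurable
    have hint : Integrable (fun p : (Vec d × Z × St) × St => ⟪B.φ p.2, p.1.1⟫_ℝ)
        (μ.map (fun ω => ((v ω, z k ω, s (k * H) ω), s (k * H + t) ω))) := by
      rw [integrable_map_measure hG.aestronglyMeasurable (hp.prodMk h2).aemeasurable]
      exact integrable_of_norm_le (hG.comp (hp.prodMk h2)).aestronglyMeasurable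
        fun ω => hbd _ _
    have hI := Measure.integral_compProd (hmap ▸ hint)
    have hsm : StronglyMeasurable fun p : Vec d × Z × St =>
        ∫ s', ⟪B.φ s', p.1⟫_ℝ ∂(Kernel.prodMkLeft (Vec d) (stateLaw M B t) p) :=
      hG.stronglyMeasurable.integral_kernel_prod_right'
    have hint' : Integrable (fun ω => ∫ s', ⟪B.φ s', v ω⟫_ℝ
        ∂(stateLaw M B t (z k ω, s (k * H) ω))) μ := by
      refine integrable_of_norm_le (R := L * R) (hsm.comp_measurable hp).aestronglyMeasurable
        fun ω => ?_
      refine (norm_integral_le_of_norm_le_const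
        (Filter.Eventually.of_forall fun x => hbd x ω)).trans ?_
      simp
    rw [← hmap, integral_map (hp.prodMk h2).aemeasurable hG.aestronglyMeasurable,
      integral_map hp.aemeasurable hsm.aestronglyMeasurable] at hI
    exact ⟨hint', hI.symm⟩
  simp_rw [hB.inner_ψState hφ]
  rw [integral_finsetSum]
  · refine Finset.sum_congr rfl fun t ht => ?_
    rw [integral_const_mul, (hcond t (Finset.mem_range.1 ht)).2]
  · exact fun t ht => (hcond t (Finset.mem_range.1 ht)).1.const_mul _

end Interaction

/-! ### Per-episode regret and its sum. -/

section Regret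

variable {Ω : Type*} [mΩ : MeasurableSpace Ω] {μ : Measure Ω} [IsProbabilityMeasure μ]
  {St Ac : Type*} [MeasurableSpace St] [MeasurableSpace Ac] {d : ℕ} {Z : Set (Vec d)}
  {M : MDP St Ac} {B : BFM Z St Ac} {H : ℕ} {ℱ : Filtration ℕ mΩ} {z : ℕ → Ω → Z}
  {s : ℕ → Ω → St} {a : ℕ → Ω → Ac} {η : ℕ → Ω → ℝ}

theorem IsInteraction.integrable_feature_inner (h : IsInteraction μ M B H ℱ z s a η) {L : ℝ}
    (hφ : ∀ x, ‖B.φ x‖ ≤ L) (w : Vec d) (τ : ℕ) :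
    Integrable (fun ω => ⟪B.φ (s τ ω), w⟫_ℝ) μ := by
  have hm := B.φ_measurable.comp (h.measurable_state τ)
  refine integrable_of_norm_le (R := L * ‖w‖) (hm.inner measurable_const).aestronglyMeasurable
    fun ω => (norm_inner_le_norm _ _).trans ?_
  exact mul_le_mul_of_nonneg_right (hφ _) (norm_nonneg _)

theorem IsInteraction.integrable_episodeReturn (h : IsInteraction μ M B H ℱ z s a η) {σ : ℝ≥0}
    (hη : IsSubgaussianNoise μ ℱ σ η) {γ L : ℝ} (hφ : ∀ x, ‖B.φ x‖ ≤ L) (zr : Z) (k : ℕ) :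
    Integrable (episodeReturn γ H (reward B zr s η) k) μ :=
  integrable_finsetSum _ fun t _ => ((h.integrable_feature_inner hφ zr (k * H + t)).add
    (hη.subgaussian (k * H + t)).integrable).const_mul (γ ^ t)

/-- The expected return of an episode is the expected value predicted at its start. -/
theorem IsInteraction.integral_episodeReturn (h : IsInteraction μ M B H ℱ z s a η) {σ : ℝ≥0}
    (hη : IsSubgaussianNoise μ ℱ σ η) {γ L : ℝ} (hB : B.IsPerfectUSF M γ H)
    (hφ : ∀ x, ‖B.φ x‖ ≤ L) (zr : Z) (k : ℕ) :
    ∫ ω, episodeReturn γ H (reward B zr s η) k ω ∂μ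
      = ∫ ω, ⟪B.ψState (s (k * H) ω) (z k ω), (zr : Vec d)⟫_ℝ ∂μ := by
  have hi := fun τ => h.integrable_feature_inner hφ (zr : Vec d) τ
  have hn := fun τ => (hη.subgaussian τ).integrable
  rw [h.integral_inner_ψState hB hφ (v := fun _ => (zr : Vec d)) measurable_const
    (fun _ => le_rfl)]
  simp only [episodeReturn, reward]
  rw [integral_finsetSum]
  · refine Finset.sum_congr rfl fun t _ => ?_
    rw [integral_const_mul, integral_add (hi _) (hn _), hη.mean_zero, add_zero]
  · exact fun t _ => ((hi (k * H + t)).add (hn (k * H + t))).const_mul (γ ^ t)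

theorem dotProduct_inv_mulVec_self_le {lam : ℝ} (hlam : 0 < lam) (f : ℕ → Vec d) (m : ℕ)
    (x : Fin d → ℝ) :
    ((gram lam f m)⁻¹ *ᵥ x) ⬝ᵥ ((gram lam f m)⁻¹ *ᵥ x) ≤ (x ⬝ᵥ x) / lam ^ 2 := by
  have h1 := lam_mul_le_dotProduct_gram_mulVec (lam := lam) f m ((gram lam f m)⁻¹ *ᵥ x)
  rw [mulVec_inv_mulVec (gram_posDef f hlam m), dotProduct_comm _ x] at h1
  have h2 := invForm_gram_le f hlam m x
  rw [le_div_iff₀ (by positivity)]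
  rw [le_div_iff₀ hlam, invForm] at h2
  nlinarith

theorem norm_toLp_inv_mulVec_le {lam : ℝ} (hlam : 0 < lam) (f : ℕ → Vec d) (m : ℕ) (x : Vec d) :
    ‖(WithLp.toLp 2 ((gram lam f m)⁻¹ *ᵥ x.ofLp) : Vec d)‖ ≤ ‖x‖ / lam := by
  have hsq : ∀ y : Vec d, ‖y‖ ^ 2 = y.ofLp ⬝ᵥ y.ofLp := fun y => by
    rw [← inner_eq_dotProduct, real_inner_self_eq_norm_sq]
  refine le_of_sq_le_sq ?_ (by positivity)
  rw [div_pow, hsq, hsq]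
  exact dotProduct_inv_mulVec_self_le hlam f m x.ofLp

/-- Young's inequality for the inverse form; the weight `c` is chosen below so that the `ψ` term can
be absorbed. -/
theorem two_mul_invForm_le {ι : Type*} [Fintype ι] [DecidableEq ι] {V : Matrix ι ι ℝ}
    (hV : V.PosDef) {c : ℝ} (hc : 0 < c) (x y : ι → ℝ) :
    2 * invForm V x y ≤ c * invForm V x x + c⁻¹ * invForm V y y := by
  have h1 := sq_invForm_le hV x y
  have hx := invForm_self_nonneg hV x
  have hy := invForm_self_nonneg hV y
  refine le_of_sq_le_sq ?_ (by positivity)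
  have h2 : c * invForm V x x * (c⁻¹ * invForm V y y) = invForm V x x * invForm V y y := by
    field_simp
  nlinarith [sq_nonneg (c * invForm V x x - c⁻¹ * invForm V y y)]

/-- The squared weighted norm of the predicted features of an episode is, in expectation, bounded
by the discounted squared weighted norms of the observed features. -/
theorem IsInteraction.integral_invForm_ψState_le (h : IsInteraction μ M B H ℱ z s a η)
    {γ L lam : ℝ} (hlam : 0 < lam) (hL : 0 ≤ L) (hγ₀ : 0 ≤ γ) (hγ₁ : γ < 1)
    (hB : B.IsPerfectUSF M γ H) (hφ : ∀ x, ‖B.φ x‖ ≤ L) (k : ℕ) :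
    Integrable (fun ω => invForm (gram lam (fun τ => B.φ (s τ ω)) (k * H))
      (B.ψState (s (k * H) ω) (z k ω)).ofLp (B.ψState (s (k * H) ω) (z k ω)).ofLp) μ ∧
    Integrable (fun ω => ∑ t ∈ Finset.range H, γ ^ t *
      invForm (gram lam (fun τ => B.φ (s τ ω)) (k * H))
        (B.φ (s (k * H + t) ω)).ofLp (B.φ (s (k * H + t) ω)).ofLp) μ ∧
    ∫ ω, invForm (gram lam (fun τ => B.φ (s τ ω)) (k * H))
      (B.ψState (s (k * H) ω) (z k ω)).ofLp (B.ψState (s (k * H) ω) (z k ω)).ofLp ∂μ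
      ≤ (1 - γ)⁻¹ * ∫ ω, ∑ t ∈ Finset.range H, γ ^ t *
        invForm (gram lam (fun τ => B.φ (s τ ω)) (k * H))
          (B.φ (s (k * H + t) ω)).ofLp (B.φ (s (k * H + t) ω)).ofLp ∂μ := by
  have hg : 0 < 1 - γ := by linarith
  have hfm : ∀ τ, Measurable[ℱ τ] fun ω => B.φ (s τ ω) := fun τ =>
    B.φ_measurable.comp (h.state_measurable τ)
  have hfm' : ∀ τ, Measurable fun ω => B.φ (s τ ω) := fun τ => (hfm τ).mono (ℱ.le _) le_rfl
  have hψm : Measurable[ℱ (k * H)] fun ω => B.ψState (s (k * H) ω) (z k ω) :=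
    (hB.measurable_ψState hφ).comp
      ((h.embedding_measurable k).prodMk (h.state_measurable (k * H)))
  have hcoord : ∀ i, Measurable fun x : Vec d => x.ofLp i := fun i => by fun_prop
  have hgram : ∀ i j, Measurable[ℱ (k * H)] fun ω =>
      gram lam (fun τ => B.φ (s τ ω)) (k * H) i j :=
    @measurable_gram_entry d lam Ω (ℱ (k * H)) (fun τ ω => B.φ (s τ ω)) _ fun τ hτ =>
      (hfm τ).mono (ℱ.mono hτ.le) le_rfl
  have hgram' : ∀ i j, Measurable fun ω => gram lam (fun τ => B.φ (s τ ω)) (k * H) i j :=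
    fun i j => (hgram i j).mono (ℱ.le _) le_rfl
  set V : Ω → Matrix (Fin d) (Fin d) ℝ := fun ω => gram lam (fun τ => B.φ (s τ ω)) (k * H)
  have hV : ∀ ω, (V ω).PosDef := fun ω => gram_posDef _ hlam _
  set ψ : Ω → Vec d := fun ω => B.ψState (s (k * H) ω) (z k ω)
  have hψb : ∀ ω, ‖ψ ω‖ ≤ (1 - γ)⁻¹ * L := fun ω => hB.norm_ψState_le hL hφ hγ₀ hγ₁ _ _
  have hψm' : Measurable ψ := hψm.mono (ℱ.le _) le_rfl
  have hψi : ∀ i, Measurable fun ω => (ψ ω).ofLp i := fun i => (hcoord i).comp hψm'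
  have hfi : ∀ τ i, Measurable fun ω => (B.φ (s τ ω)).ofLp i := fun τ i => (hcoord i).comp (hfm' τ)
  -- This vector is known at the start of the episode and bounded, and `⟪ψ, v⟫ = ‖ψ‖²` in the
  -- inverse form. Testing the conditional mean identity against it replaces one factor `ψ` by
  -- observed features.
  set v : Ω → Vec d := fun ω => WithLp.toLp 2 ((V ω)⁻¹ *ᵥ (ψ ω).ofLp)
  have hvm : Measurable[ℱ (k * H)] v := by
    refine (by fun_prop : Measurable fun x : Fin d → ℝ => (WithLp.toLp 2 x : Vec d)).comp ?_
    refine @measurable_pi_lambda _ _ _ (ℱ (k * H)) _ _ fun i => ?_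
    simp only [Matrix.mulVec, dotProduct]
    exact @Finset.measurable_sum _ _ _ _ _ _ (ℱ (k * H)) _ _ fun j _ =>
      (@measurable_inv_entry Ω (ℱ (k * H)) _ _ _ _ hgram i j).mul ((hcoord j).comp hψm)
  have hvb : ∀ ω, ‖v ω‖ ≤ (1 - γ)⁻¹ * L / lam := fun ω =>
    (norm_toLp_inv_mulVec_le hlam _ _ _).trans (by gcongr; exact hψb ω)
  have hkey := h.integral_inner_ψState hB hφ hvm hvb
  have hQ : ∀ ω, ⟪ψ ω, v ω⟫_ℝ = invForm (V ω) (ψ ω).ofLp (ψ ω).ofLp := fun ω => by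
    rw [inner_eq_dotProduct]; rfl
  have hF : ∀ ω τ, ⟪B.φ (s τ ω), v ω⟫_ℝ = invForm (V ω) (B.φ (s τ ω)).ofLp (ψ ω).ofLp :=
    fun ω τ => by rw [inner_eq_dotProduct]; rfl
  have hQint : Integrable (fun ω => invForm (V ω) (ψ ω).ofLp (ψ ω).ofLp) μ := by
    refine integrable_of_norm_le (R := ((1 - γ)⁻¹ * L) ^ 2 / lam)
      (measurable_invForm hgram' hψi hψi).aestronglyMeasurable fun ω => ?_
    rw [Real.norm_of_nonneg (invForm_self_nonneg (hV ω) _)]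
    refine (invForm_gram_le _ hlam _ _).trans ?_
    have := dotProduct_self_le (hψb ω)
    gcongr
  have hYint : Integrable (fun ω => ∑ t ∈ Finset.range H, γ ^ t *
      invForm (V ω) (B.φ (s (k * H + t) ω)).ofLp (B.φ (s (k * H + t) ω)).ofLp) μ := by
    refine integrable_finsetSum _ fun t _ => Integrable.const_mul ?_ _
    refine integrable_of_norm_le (R := L ^ 2 / lam)
      (measurable_invForm hgram' (hfi _) (hfi _)).aestronglyMeasurable fun ω => ?_
    rw [Real.norm_of_nonneg (invForm_self_nonneg (hV ω) _)]
    exact invForm_feature_le (fun τ => B.φ (s τ ω)) hlam (fun _ => hφ _) _ _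
  have hFint : ∀ t, Integrable (fun ω => ⟪B.φ (s (k * H + t) ω), v ω⟫_ℝ) μ := fun t =>
    integrable_of_norm_le (R := L * ((1 - γ)⁻¹ * L / lam))
      ((hfm' _).inner (hvm.mono (ℱ.le _) le_rfl)).aestronglyMeasurable fun ω =>
        (norm_inner_le_norm _ _).trans (mul_le_mul (hφ _) (hvb ω) (norm_nonneg _) hL)
  refine ⟨hQint, hYint, ?_⟩
  -- Young with weight `(1 - γ)⁻¹`: the `ψ` terms carry the factor `(1 - γ) / 2`, and the geometric
  -- sum brings them to at most `1 / 2`. After integration half of the left side is absorbed.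
  have hpt : ∀ ω, ∑ t ∈ Finset.range H, γ ^ t * ⟪B.φ (s (k * H + t) ω), v ω⟫_ℝ
      ≤ (1 - γ)⁻¹ / 2 * (∑ t ∈ Finset.range H, γ ^ t *
      invForm (V ω) (B.φ (s (k * H + t) ω)).ofLp (B.φ (s (k * H + t) ω)).ofLp)
      + 1 / 2 * invForm (V ω) (ψ ω).ofLp (ψ ω).ofLp := by
    intro ω
    have h0 := invForm_self_nonneg (hV ω) (ψ ω).ofLp
    have hs := geom_sum_le hγ₀ hγ₁ H
    calc _ ≤ ∑ t ∈ Finset.range H, γ ^ t * ((1 - γ)⁻¹ / 2 *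
          invForm (V ω) (B.φ (s (k * H + t) ω)).ofLp (B.φ (s (k * H + t) ω)).ofLp
          + (1 - γ) / 2 * invForm (V ω) (ψ ω).ofLp (ψ ω).ofLp) := by
          gcongr with t
          have := two_mul_invForm_le (hV ω) (inv_pos.2 hg) (B.φ (s (k * H + t) ω)).ofLp (ψ ω).ofLp
          rw [inv_inv] at this
          rw [hF]
          linarith
      _ = (1 - γ)⁻¹ / 2 * (∑ t ∈ Finset.range H, γ ^ t *
          invForm (V ω) (B.φ (s (k * H + t) ω)).ofLp (B.φ (s (k * H + t) ω)).ofLp)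
          + (∑ t ∈ Finset.range H, γ ^ t) * ((1 - γ) / 2 *
            invForm (V ω) (ψ ω).ofLp (ψ ω).ofLp) := by
          simp only [mul_add, Finset.sum_add_distrib, Finset.mul_sum, Finset.sum_mul]
          congr 1
          exact Finset.sum_congr rfl fun t _ => by ring
      _ ≤ (1 - γ)⁻¹ / 2 * (∑ t ∈ Finset.range H, γ ^ t *
          invForm (V ω) (B.φ (s (k * H + t) ω)).ofLp (B.φ (s (k * H + t) ω)).ofLp)
          + (1 - γ)⁻¹ * ((1 - γ) / 2 * invForm (V ω) (ψ ω).ofLp (ψ ω).ofLp) := by gcongr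
      _ = _ := by field_simp
  have hmono := integral_mono (integrable_finsetSum _ fun t _ => (hFint t).const_mul (γ ^ t))
    ((hYint.const_mul ((1 - γ)⁻¹ / 2)).add (hQint.const_mul (1 / 2))) hpt
  rw [integral_add' (hYint.const_mul _) (hQint.const_mul _), integral_const_mul, integral_const_mul,
    integral_finsetSum _ fun t _ => (hFint t).const_mul (γ ^ t)] at hmono
  simp only [integral_const_mul] at hmono
  rw [← hkey, integral_congr_ae (Filter.Eventually.of_forall hQ)] at hmono
  change ∫ ω, invForm (V ω) (ψ ω).ofLp (ψ ω).ofLp ∂μ ≤ (1 - γ)⁻¹ * ∫ ω, ∑ t ∈ Finset.range H,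
    γ ^ t * invForm (V ω) (B.φ (s (k * H + t) ω)).ofLp (B.φ (s (k * H + t) ω)).ofLp ∂μ
  linarith

/-- The radius of the confidence ellipsoids with `δ = 1 / n` during the first `n` episodes. -/
theorem radius_le {lam S L : ℝ} {σ : ℝ≥0} (hlam : 0 < lam) (hS : 0 ≤ S) {f : ℕ → Vec d}
    (hf : ∀ i, ‖f i‖ ≤ L) (hd : 0 < d) {n k : ℕ} (hH : 0 < H) (hk : k < n) :
    radius lam S σ (1 / n) f (k * H)
      ≤ (√lam * S * √2 + σ * √(3 + L ^ 2 / lam)) * √(d * Real.log (1 + n * H)) := by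
  have hn : (1 : ℝ) ≤ n := by exact_mod_cast (by omega : 1 ≤ n)
  have hH1 : (1 : ℝ) ≤ H := by exact_mod_cast hH
  have hd1 : (1 : ℝ) ≤ d := by exact_mod_cast hd
  have hkn : ((k * H : ℕ) : ℝ) ≤ n * H := by exact_mod_cast Nat.mul_le_mul_right H hk.le
  have hnH : (n : ℝ) ≤ n * H := le_mul_of_one_le_right (by linarith) hH1
  have h1 := log_det_gram_le f hlam hf hkn
  have h2 : Real.log n ≤ Real.log (1 + n * H) := Real.log_le_log (by linarith) (by linarith)
  have h3 : Real.log 2 ≤ Real.log (1 + n * H) := Real.log_le_log (by norm_num) (by linarith)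
  have h4 := Real.log_two_gt_d9
  set l := Real.log (1 + (n : ℝ) * H)
  have hl : l ≤ d * l := le_mul_of_one_le_left (by linarith) hd1
  have h0 : 0 ≤ L ^ 2 / lam := by positivity
  rw [radius, one_div_one_div, add_mul]
  refine add_le_add ?_ ?_
  -- The factor `√2` is there because `log 2 > 1 / 2`, so that `2 d log (1 + n H) ≥ 1`.
  · rw [mul_assoc _ √2, ← Real.sqrt_mul (by norm_num)]
    refine le_mul_of_one_le_right (by positivity) (Real.one_le_sqrt.2 ?_)
    linarith
  · rw [mul_assoc, ← Real.sqrt_mul (by positivity)]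
    gcongr
    nlinarith

theorem two_mul_sqrt_mul_sqrt_le {x y r : ℝ} (hx : 0 ≤ x) (hy : 0 ≤ y) (hr : 0 < r) :
    2 * √x * √y ≤ x / r + r * y := by
  have h1 := Real.sq_sqrt hx
  have h2 := Real.sq_sqrt hy
  have h3 : 0 ≤ (√x - r * √y) ^ 2 / r := by positivity
  have h4 : (√x - r * √y) ^ 2 / r = √x ^ 2 / r + r * √y ^ 2 - 2 * √x * √y := by
    field_simp
    ring
  rw [h4, h1, h2] at h3
  linarith

/-- The expected regret of one episode of the optimistic algorithm. -/
theorem IsInteraction.integral_episode_regret_le (h : IsInteraction μ M B H ℱ z s a η)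
    {γ L lam S : ℝ} {σ : ℝ≥0} (hη : IsSubgaussianNoise μ ℱ σ η)
    (hlam : 0 < lam) (hS : 0 ≤ S) (hL : 0 ≤ L) (hγ₀ : 0 ≤ γ) (hγ₁ : γ < 1)
    (hB : B.IsPerfectUSF M γ H) (hφ : ∀ x, ‖B.φ x‖ ≤ L) {zr : Z} (hzr : ‖(zr : Vec d)‖ ≤ S)
    {n : ℕ} (hopt : IsOptimistic μ B H lam S σ (1 / n) n z s (reward B zr s η))
    (hd : 0 < d) (hH : 0 < H) {k : ℕ} (hk : k < n) :
    ∫ ω, ⟪B.ψState (s (k * H) ω) zr, (zr : Vec d)⟫_ℝ ∂μ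
      - ∫ ω, ⟪B.ψState (s (k * H) ω) (z k ω), (zr : Vec d)⟫_ℝ ∂μ
      ≤ (√lam * S * √2 + σ * √(3 + L ^ 2 / lam)) * (d * Real.log (1 + n * H) / √n
        + √n * ∫ ω, invForm (gram lam (fun τ => B.φ (s τ ω)) (k * H))
          (B.ψState (s (k * H) ω) (z k ω)).ofLp (B.ψState (s (k * H) ω) (z k ω)).ofLp ∂μ)
        + 2 * ((1 - γ)⁻¹ * L * S) * (1 / n) := by
  have hn : (0 : ℝ) < n := by exact_mod_cast (by omega : 0 < n)
  have hg : 0 < 1 - γ := by linarith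
  have hlog : 0 ≤ Real.log (1 + (n : ℝ) * H) := Real.log_nonneg (by
    have : (0 : ℝ) ≤ n * H := by positivity
    linarith)
  have hfm : ∀ τ, Measurable[ℱ τ] fun ω => B.φ (s τ ω) := fun τ =>
    B.φ_measurable.comp (h.state_measurable τ)
  obtain ⟨A, hA, hAμ, hAc⟩ := exists_confidence_failure_set (μ := μ) hlam hfm h.noise_measurable
    hη hS hzr (one_div_pos.2 hn) (k * H)
  have hbound : ∀ x (y : Z), |⟪B.ψState x y, (zr : Vec d)⟫_ℝ| ≤ (1 - γ)⁻¹ * L * S := fun x y =>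
    (abs_real_inner_le_norm _ _).trans (mul_le_mul (hB.norm_ψState_le hL hφ hγ₀ hγ₁ x y) hzr
      (norm_nonneg _) (by positivity))
  have hint : ∀ y : Ω → Z, Measurable y →
      Integrable (fun ω => ⟪B.ψState (s (k * H) ω) (y ω), (zr : Vec d)⟫_ℝ) μ := fun y hy =>
    integrable_of_norm_le (((hB.measurable_ψState hφ).comp
      (hy.prodMk (h.measurable_state (k * H)))).inner measurable_const).aestronglyMeasurable
      fun ω => hbound _ _
  obtain ⟨hQint, -, -⟩ := h.integral_invForm_ψState_le hlam hL hγ₀ hγ₁ hB hφ k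
  set Q : Ω → ℝ := fun ω => invForm (gram lam (fun τ => B.φ (s τ ω)) (k * H))
    (B.ψState (s (k * H) ω) (z k ω)).ofLp (B.ψState (s (k * H) ω) (z k ω)).ofLp
  have hQ0 : ∀ ω, 0 ≤ Q ω := fun ω => invForm_self_nonneg (gram_posDef _ hlam _) _
  set b := √lam * S * √2 + σ * √(3 + L ^ 2 / lam) with hb
  have hb0 : 0 ≤ b := by positivity
  set D := (1 - γ)⁻¹ * L * S
  have hD : 0 ≤ D := by positivity
  set l := d * Real.log (1 + (n : ℝ) * H)
  have hl0 : 0 ≤ l := by positivity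
  have hpt : ∀ᵐ ω ∂μ, ⟪B.ψState (s (k * H) ω) zr, (zr : Vec d)⟫_ℝ
      - ⟪B.ψState (s (k * H) ω) (z k ω), (zr : Vec d)⟫_ℝ
      ≤ b * (l / √n + √n * Q ω) + A.indicator (fun _ => 2 * D) ω := by
    filter_upwards [hopt k hk] with ω hω
    have hrest : 0 ≤ b * (l / √n + √n * Q ω) := by
      have := hQ0 ω
      positivity
    by_cases hωA : ω ∈ A
    · rw [Set.indicator_of_mem hωA]
      have h1 := (abs_le.1 (hbound (s (k * H) ω) zr)).2
      have h2 := (abs_le.1 (hbound (s (k * H) ω) (z k ω))).1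
      linarith
    · rw [Set.indicator_of_notMem hωA, add_zero]
      have h1 := inner_sub_inner_le_of_ucb_le _ hlam (hAc ω hωA) (hω zr)
      refine h1.trans ?_
      have hr := radius_le (σ := σ) (S := S) hlam hS (f := fun τ => B.φ (s τ ω)) (fun _ => hφ _)
        hd hH hk
      -- The weight `√n` balances the two sums over `n` episodes: `n · l / √n` and `√n` times the
      -- potential are both of order `l √n`.
      have hm := two_mul_sqrt_mul_sqrt_le hl0 (hQ0 ω) (r := √n) (by positivity)
      calc _ ≤ 2 * (b * √l) * √(Q ω) := by gcongr
        _ = b * (2 * √l * √(Q ω)) := by ring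
        _ ≤ _ := by gcongr
  have hi₁ : Integrable (fun ω => b * (l / √n + √n * Q ω)) μ :=
    ((integrable_const (l / √n)).add (hQint.const_mul √n)).const_mul b
  have hi₂ : Integrable (A.indicator fun _ => 2 * D) μ := (integrable_const (2 * D)).indicator hA
  have hmono := integral_mono_ae ((hint _ measurable_const).sub (hint _ (h.measurable_embedding k)))
    (hi₁.add hi₂) hpt
  simp only [Pi.add_apply, Pi.sub_apply] at hmono
  rw [integral_sub (hint _ measurable_const) (hint _ (h.measurable_embedding k)),
    integral_add hi₁ hi₂, integral_indicator hA, integral_const_mul,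
    integral_add (integrable_const (l / √n)) (hQint.const_mul √n), integral_const_mul,
    integral_const, setIntegral_const, probReal_univ, one_smul, smul_eq_mul, mul_comm _ (2 * D)]
    at hmono
  refine hmono.trans ?_
  have hAr : μ.real A ≤ 1 / n := ENNReal.toReal_le_of_le_ofReal (by positivity) hAμ
  gcongr

/-- The sum over the episodes of the expected squared weighted norms of the predicted features. -/
theorem IsInteraction.sum_integral_invForm_ψState_le (h : IsInteraction μ M B H ℱ z s a η)
    {γ L lam : ℝ} (hlam : 0 < lam) (hL : 0 ≤ L) (hγ₀ : 0 ≤ γ) (hγ₁ : γ < 1)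
    (hB : B.IsPerfectUSF M γ H) (hφ : ∀ x, ‖B.φ x‖ ≤ L) (n : ℕ) :
    ∑ k ∈ Finset.range n, ∫ ω, invForm (gram lam (fun τ => B.φ (s τ ω)) (k * H))
      (B.ψState (s (k * H) ω) (z k ω)).ofLp (B.ψState (s (k * H) ω) (z k ω)).ofLp ∂μ
      ≤ (1 - γ)⁻¹ * ((1 + (1 - γ)⁻¹ * (L ^ 2 / lam)) * (1 + L ^ 2 / lam))
        * (d * Real.log (1 + n * H)) := by
  have hg : 0 < 1 - γ := by linarith
  have hk := fun k => h.integral_invForm_ψState_le hlam hL hγ₀ hγ₁ hB hφ k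
  refine (Finset.sum_le_sum fun k _ => (hk k).2.2).trans ?_
  rw [← Finset.mul_sum, ← integral_finsetSum _ fun k _ => (hk k).2.1, mul_assoc]
  refine mul_le_mul_of_nonneg_left ?_ (by positivity)
  refine (integral_mono (integrable_finsetSum _ fun k _ => (hk k).2.1)
    (integrable_const ((1 + (1 - γ)⁻¹ * (L ^ 2 / lam)) * (1 + L ^ 2 / lam)
      * (d * Real.log (1 + n * H)))) fun ω => ?_).trans (by simp)
  refine (sum_discounted_invForm_le (fun τ => B.φ (s τ ω)) hlam (fun _ => hφ _) hγ₀ hγ₁ H n).trans ?_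
  rw [mul_assoc]
  refine mul_le_mul_of_nonneg_left ?_ (by positivity)
  refine (log_det_gram_le _ hlam (fun _ => hφ _) (N := n * H) (by simp)).trans (le_of_eq ?_)
  ring

end Regret

end OptiBFM

/-! ### Assembly of the regret bound. -/

theorem proposition2 (γ lam S L : ℝ) (σ : ℝ≥0)
    (hγ₀ : 0 ≤ γ) (hγ₁ : γ < 1) (hlam : 0 < lam) (hS : 0 < S) (hL : 0 < L) :
    ∃ C : ℝ, ∀ (d H n : ℕ), 0 < H → 0 < n →
      ∀ (St Ac : Type*) [MeasurableSpace St] [MeasurableSpace Ac]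
        (M : OptiBFM.MDP St Ac) (Z : Set (OptiBFM.Vec d)) (B : OptiBFM.BFM Z St Ac) (zr : Z),
        B.IsPerfectUSF M γ H →
        ‖(zr : OptiBFM.Vec d)‖ ≤ S →
        (∀ x, ‖B.φ x‖ ≤ L) →
      ∀ (Ω : Type*) [mΩ : MeasurableSpace Ω] (μ : Measure Ω) [IsProbabilityMeasure μ]
        (ℱ ℱ' : Filtration ℕ mΩ)
        (z : ℕ → Ω → Z) (s s' : ℕ → Ω → St) (a a' : ℕ → Ω → Ac) (η η' : ℕ → Ω → ℝ),
        -- the interaction of the algorithm, with `δ = 1 / n`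
        OptiBFM.IsInteraction μ M B H ℱ z s a η →
        OptiBFM.IsSubgaussianNoise μ ℱ σ η →
        OptiBFM.IsOptimistic μ B H lam S σ (1 / n) n z s (OptiBFM.reward B zr s η) →
        -- the interaction that always uses the embedding `zr`
        OptiBFM.IsInteraction μ M B H ℱ' (fun _ _ => zr) s' a' η' →
        OptiBFM.IsSubgaussianNoise μ ℱ' σ η' →
        Integrable (OptiBFM.regret γ H n
          (OptiBFM.reward B zr s' η') (OptiBFM.reward B zr s η)) μ ∧
        ∫ ω, OptiBFM.regret γ H n
          (OptiBFM.reward B zr s' η') (OptiBFM.reward B zr s η) ω ∂μ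
            ≤ C * d * √n * Real.log (1 + n * H) := by
  have hg : 0 < 1 - γ := by linarith
  set b := √lam * S * √2 + σ * √(3 + L ^ 2 / lam) with hb
  set c := (1 - γ)⁻¹ * ((1 + (1 - γ)⁻¹ * (L ^ 2 / lam)) * (1 + L ^ 2 / lam)) with hc
  set D := 2 * ((1 - γ)⁻¹ * L * S) with hDdef
  have hb0 : 0 ≤ b := by positivity
  have hD0 : 0 ≤ D := by positivity
  -- Here `b` bounds the radius, `c` the potential, and `D` is the total cost of the failure events;
  -- the factor 2 lets `2 d √n log (1 + n H) ≥ 1` absorb `D`.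
  refine ⟨b * (1 + c) + 2 * D, ?_⟩
  intro d H n hH hn St Ac _ _ M Z B zr hB hzr hφ Ω mΩ μ _ ℱ ℱ' z s s' a a' η η' h hη hopt h' hη'
  have hI := fun k => h.integrable_episodeReturn hη (γ := γ) hφ zr k
  have hI' := fun k => h'.integrable_episodeReturn hη' (γ := γ) hφ zr k
  refine ⟨integrable_finsetSum _ fun k _ => (hI' k).sub (hI k), ?_⟩
  have hψm : Measurable fun x => ⟪B.ψState x zr, (zr : OptiBFM.Vec d)⟫_ℝ :=
    ((hB.measurable_ψState hφ).comp (measurable_prodMk_left (x := zr))).inner measurable_const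
  have hstart : ∀ k, ∫ ω, ⟪B.ψState (s' (k * H) ω) zr, (zr : OptiBFM.Vec d)⟫_ℝ ∂μ
      = ∫ ω, ⟪B.ψState (s (k * H) ω) zr, (zr : OptiBFM.Vec d)⟫_ℝ ∂μ := by
    intro k
    rw [← integral_map (h'.measurable_state _).aemeasurable hψm.aestronglyMeasurable,
      ← integral_map (h.measurable_state _).aemeasurable hψm.aestronglyMeasurable,
      h.map_state_start hH, h'.map_state_start hH]
  have hreg : ∫ ω, OptiBFM.regret γ H n
      (OptiBFM.reward B zr s' η') (OptiBFM.reward B zr s η) ω ∂μ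
      = ∑ k ∈ Finset.range n, (∫ ω, ⟪B.ψState (s (k * H) ω) zr, (zr : OptiBFM.Vec d)⟫_ℝ ∂μ
        - ∫ ω, ⟪B.ψState (s (k * H) ω) (z k ω), (zr : OptiBFM.Vec d)⟫_ℝ ∂μ) := by
    simp only [OptiBFM.regret]
    rw [integral_finsetSum]
    · refine Finset.sum_congr rfl fun k _ => ?_
      rw [integral_sub (hI' k) (hI k), h.integral_episodeReturn hη hB hφ,
        h'.integral_episodeReturn hη' hB hφ, hstart]
    · exact fun k _ => (hI' k).sub (hI k)
  rw [hreg]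
  -- For `d = 0` the radius is not controlled by `√(d log (1 + n H)) = 0`, but all inner products
  -- vanish.
  rcases Nat.eq_zero_or_pos d with rfl | hd
  · have h0 : ∀ x y : OptiBFM.Vec 0, ⟪x, y⟫_ℝ = 0 := fun x y => by
      rw [Subsingleton.elim x 0, inner_zero_left]
    simp [h0]
  have hn1 : (1 : ℝ) ≤ n := by exact_mod_cast hn
  have hd1 : (1 : ℝ) ≤ d := by exact_mod_cast hd
  have hH1 : (1 : ℝ) ≤ H := by exact_mod_cast hH
  have hlog : 1 / 2 ≤ Real.log (1 + (n : ℝ) * H) := by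
    have h1 : Real.log 2 ≤ Real.log (1 + (n : ℝ) * H) :=
      Real.log_le_log (by norm_num) (by nlinarith)
    linarith [Real.log_two_gt_d9]
  have hsqrt : 1 ≤ √(n : ℝ) := Real.one_le_sqrt.2 hn1
  have hsq : √(n : ℝ) * √(n : ℝ) = n := Real.mul_self_sqrt (by linarith)
  refine (Finset.sum_le_sum fun k hk => h.integral_episode_regret_le hη hlam hS.le hL.le hγ₀ hγ₁
    hB hφ hzr hopt hd hH (Finset.mem_range.1 hk)).trans ?_
  have hsum := h.sum_integral_invForm_ψState_le hlam hL.le hγ₀ hγ₁ hB hφ n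
  rw [Finset.sum_add_distrib, ← Finset.mul_sum, Finset.sum_add_distrib, ← Finset.mul_sum]
  simp only [Finset.sum_const, Finset.card_range, nsmul_eq_mul]
  rw [← hb, ← hDdef]
  rw [← hc] at hsum
  set l := Real.log (1 + (n : ℝ) * H)
  have e1 : (n : ℝ) * (d * l / √n) = d * l * √n := by
    nth_rewrite 1 [← hsq]
    field_simp
  have e2 : (n : ℝ) * (D * (1 / n)) = D := by field_simp
  have e3 : 1 ≤ 2 * (d * √n * l) := by
    have : 1 ≤ (d : ℝ) * √n := one_le_mul_of_one_le_of_one_le hd1 hsqrt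
    nlinarith
  rw [e1, e2]
  calc _ ≤ b * (d * l * √n + √n * (c * (d * l))) + D * (2 * (d * √n * l)) := by
        gcongr
        exact le_mul_of_one_le_right hD0 e3
    _ = _ := by ring
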